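/- Let $k$ be an algebraically closed field of characteristic zero, let $m,n\ge 1$, let $\zeta_m,\zeta_n\in k^*$ be primitive roots of unity of orders $m$ and $n$, and let $G=\mathbb{Z}_m\times\mathbb{Z}_n$ with generators $g_1,g_2$. Let $\operatorname{Vec}_G$ be the $k$-linear category of finite-dimensional $G$-graded vector spaces and degree-preserving linear maps, with the graded tensor product $(V\otimes W)_g=\bigoplus_{xy=g}V_x\otimes W_y$. For integers $0\le a<m$, $0\le b<(m,n)$, $0\le d<n$, let $\Phi_{a,b,d}$ be the normalized 3-cocycle on $G$ with values in $k^*$ given, for exponents $0\le i,s,p<m$ and $0\le j,t,l<n$, by $$\Phi_{a,b,d}(g_1^ig_2^j,\,g_1^sg_2^t,\,g_1^pg_2^l)=\zeta_m^{a\lfloor (p+s)/m\rfloor i}\,\zeta_n^{b\lfloor (p+s)/m\rfloor j}\,\zeta_n^{d\lfloor (t+l)/n\rfloor j}.$$ Let $A_{a,b,d}$ be the (possibly empty) set of $\underline r=(r_{11},r_{12},r_{21},r_{22})\in (k^*)^4$ with $$r_{11}^m=\zeta_m^a=\zeta_m^{-a},\quad r_{22}^n=\zeta_n^d=\zeta_n^{-d},\quad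 r_{12}^n=1,\ r_{12}^m=\zeta_n^{-b},\quad r_{21}^n=1,\ r_{21}^m=\zeta_n^{b},$$ and for $\underline r\in A_{a,b,d}$ put $\mathcal R_{\underline r}(g_1^ig_2^j,g_1^sg_2^t)=r_{11}^{is}r_{12}^{it}r_{21}^{js}r_{22}^{jt}$ for $0\le i,s<m$ and $0\le j,t<n$. Let $(\operatorname{Vec}_G^{\Phi_{a,b,d}},\mathcal R_{\underline r})$ be the braided monoidal category $\operatorname{Vec}_G$ with the graded tensor product, the unit object $k$ in the trivial degree with the usual unit constraints, the associativity constraint $(v\otimes w)\otimes u\mapsto\Phi_{a,b,d}(x,y,z)\,v\otimes(w\otimes u)$ and the braiding $v\otimes w\mapsto\mathcal R_{\underline r}(x,y)\,w\otimes v$ on homogeneous elements $v,w,u$ of degrees $x,y,z$. Theorem. Every braided monoidal structure on $(\operatorname{Vec}_G,\otimes)$, that is, every braided monoidal structure on the category $\operatorname{Vec}_G$ whose tensor product bifunctor is (up to natural isomorphism) the graded tensor product, is tensor equivalent to $(\operatorname{Vec}_G^{\Phi_{a,b,d}},\mathcal R_{\underline r})$ for some $a\in\{0,\dots,m-1\}$,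 $b\in\{0,\dots,(m,n)-1\}$, $d\in\{0,\dots,n-1\}$ and $\underline r\in A_{a,b,d}$. Here tensor equivalent means that there is a $k$-linear equivalence of categories that is a strong braided monoidal functor. -/

import Mathlib

open CategoryTheory MonoidalCategory
open scoped TensorProduct

universe u w

set_option linter.unusedSectionVars false

noncomputable section

/-- A finite-dimensional `G`-graded vector space over `k`: a finite-dimensional space `V`
with subspaces `V_g` (`g : G`) such that `V` is the internal direct sum of the `V_g`. -/
structure GrVec (k : Type u) [Field k] (G : Type w) [DecidableEq G] where
  carrier : Type u
  [addCommGroup : AddCommGroup carrier]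
  [module : Module k carrier]
  [finiteDimensional : FiniteDimensional k carrier]
  /-- the homogeneous components -/
  comp : G → Submodule k carrier
  isInternal : DirectSum.IsInternal comp

namespace GrVec

attribute [instance] GrVec.addCommGroup GrVec.module GrVec.finiteDimensional

section Basic

variable {k : Type u} [Field k] {G : Type w} [DecidableEq G]

/-- The space of degree-preserving linear maps. -/
def homs (V W : GrVec k G) : Submodule k (V.carrier →ₗ[k] W.carrier) where
  carrier := {f | ∀ g, ∀ v ∈ V.comp g, f v ∈ W.comp g}
  add_mem' hf hf' g v hv := (W.comp g).add_mem (hf g v hv) (hf' g v hv)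
  zero_mem' g _ _ := (W.comp g).zero_mem
  smul_mem' c _ hf g v hv := (W.comp g).smul_mem c (hf g v hv)

/-- `Vec_G`: morphisms are the degree-preserving linear maps. -/
instance : Category (GrVec k G) where
  Hom V W := homs V W
  id _ := ⟨LinearMap.id, fun _ _ hv => hv⟩
  comp f f' := ⟨f'.1.comp f.1, fun g v hv => f'.2 g _ (f.2 g v hv)⟩

/-- The linear map underlying a morphism. -/
def lin {V W : GrVec k G} (f : V ⟶ W) : V.carrier →ₗ[k] W.carrier := Subtype.val f

/-- The morphism given by a degree-preserving linear map. -/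
def ofLin {V W : GrVec k G} (f : V.carrier →ₗ[k] W.carrier)
    (hf : ∀ g, ∀ v ∈ V.comp g, f v ∈ W.comp g) : V ⟶ W := ⟨f, hf⟩

theorem lin_mem {V W : GrVec k G} (f : V ⟶ W) {g : G} {v : V.carrier} (hv : v ∈ V.comp g) :
    lin f v ∈ W.comp g := f.2 g v hv

@[ext] theorem hom_ext {V W : GrVec k G} {f f' : V ⟶ W} (h : lin f = lin f') : f = f' :=
  Subtype.ext h

@[simp] theorem lin_ofLin {V W : GrVec k G} (f : V.carrier →ₗ[k] W.carrier)
    (hf : ∀ g, ∀ v ∈ V.comp g, f v ∈ W.comp g) : lin (ofLin f hf) = f := rfl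

@[simp] theorem lin_id (V : GrVec k G) : lin (𝟙 V) = LinearMap.id := rfl

@[simp] theorem lin_comp {U V W : GrVec k G} (f : U ⟶ V) (f' : V ⟶ W) :
    lin (f ≫ f') = (lin f').comp (lin f) := rfl

instance : Preadditive (GrVec k G) where
  homGroup V W := inferInstanceAs (AddCommGroup (homs V W))
  add_comp _ _ _ f f' g := Subtype.ext (LinearMap.comp_add f.1 f'.1 g.1)
  comp_add _ _ _ f g g' := Subtype.ext (LinearMap.add_comp f.1 g'.1 g.1)

instance : Linear k (GrVec k G) where
  homModule V W := inferInstanceAs (Module k (homs V W))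
  smul_comp _ _ _ c f g := Subtype.ext (LinearMap.comp_smul g.1 c f.1)
  comp_smul _ _ _ f c g := Subtype.ext (LinearMap.smul_comp c g.1 f.1)

/-- The projection of `V` onto its component `V_g`. -/
def proj (V : GrVec k G) (g : G) : V.carrier →ₗ[k] V.carrier :=
  (V.comp g).subtype ∘ₗ DirectSum.component k G (fun i => V.comp i) g ∘ₗ
    (LinearEquiv.ofBijective (DirectSum.coeLinearMap V.comp) V.isInternal).symm.toLinearMap

theorem proj_mem (V : GrVec k G) (g : G) (v : V.carrier) : V.proj g v ∈ V.comp g :=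
  Submodule.coe_mem _

theorem proj_same (V : GrVec k G) {g : G} {v : V.carrier} (hv : v ∈ V.comp g) :
    V.proj g v = v :=
  congrArg Subtype.val (V.isInternal.ofBijective_coeLinearMap_of_mem hv)

theorem proj_ne (V : GrVec k G) {g g' : G} (h : g ≠ g') {v : V.carrier} (hv : v ∈ V.comp g) :
    V.proj g' v = 0 :=
  congrArg Subtype.val (V.isInternal.ofBijective_coeLinearMap_of_mem_ne h hv)

theorem proj_of_mem (V : GrVec k G) {g : G} (g' : G) {v : V.carrier} (hv : v ∈ V.comp g) :
    V.proj g' v = if g = g' then v else 0 := by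
  split_ifs with h
  · subst h; exact V.proj_same hv
  · exact V.proj_ne h hv

/-- Linear maps that agree on homogeneous elements agree. -/
theorem ext_homog {X : Type*} [AddCommMonoid X] [Module k X] (V : GrVec k G)
    {f f' : V.carrier →ₗ[k] X} (h : ∀ g, ∀ v ∈ V.comp g, f v = f' v) : f = f' := by
  ext v
  have hv : v ∈ ⨆ g, V.comp g := by
    rw [V.isInternal.submodule_iSup_eq_top]; trivial
  induction hv using Submodule.iSup_induction' with
  | mem g v hv => exact h g v hv
  | zero => simp
  | add x y _ _ hx hy => simp [hx, hy]

theorem sum_proj [Fintype G] (V : GrVec k G) : ∑ g, V.proj g = LinearMap.id := by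
  apply V.ext_homog
  intro g v hv
  simp [LinearMap.sum_apply, V.proj_of_mem _ hv]

theorem isInternal_of_proj [Fintype G] {M : Type*} [AddCommGroup M] [Module k M]
    (c : G → Submodule k M) (p : G → M →ₗ[k] M) (hp : ∀ g v, p g v ∈ c g)
    (hs : ∀ v, ∑ g, p g v = v) (hc : ∀ g, ∀ v ∈ c g, ∀ g', p g' v = if g = g' then v else 0) :
    DirectSum.IsInternal c := by
  refine DirectSum.isInternal_submodule_of_iSupIndep_of_iSup_eq_top ?_ ?_
  · rw [iSupIndep_def]
    intro g
    rw [Submodule.disjoint_def]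
    intro v hv hv'
    have h0 : (⨆ (j : G) (_ : j ≠ g), c j) ≤ LinearMap.ker (p g) :=
      iSup₂_le fun j hj x hx => by simp [hc j x hx, hj]
    have h1 := h0 hv'
    rw [LinearMap.mem_ker, hc g v hv g, if_pos rfl] at h1
    exact h1
  · rw [eq_top_iff]
    intro v _
    rw [← hs v]
    exact Submodule.sum_mem _ fun g _ => Submodule.mem_iSup_of_mem g (hp g v)

end Basic

section Tensor

variable {k : Type u} [Field k] {G : Type w} [DecidableEq G] [Fintype G] [AddCommGroup G]

/-- The component of degree `g` of `V ⊗ W`, namely `∑_{x + y = g} V_x ⊗ W_y`. -/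
def tensorComp (V W : GrVec k G) (g : G) : Submodule k (V.carrier ⊗[k] W.carrier) :=
  ⨆ (x : G) (y : G) (_ : x + y = g),
    Submodule.map₂ (TensorProduct.mk k V.carrier W.carrier) (V.comp x) (W.comp y)

theorem tmul_mem {V W : GrVec k G} {x y : G} {v : V.carrier} {w : W.carrier}
    (hv : v ∈ V.comp x) (hw : w ∈ W.comp y) : v ⊗ₜ[k] w ∈ tensorComp V W (x + y) :=
  Submodule.mem_iSup_of_mem x (Submodule.mem_iSup_of_mem y (Submodule.mem_iSup_of_mem rfl
    (Submodule.apply_mem_map₂ (TensorProduct.mk k V.carrier W.carrier) hv hw)))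

theorem tmul_mem' {V W : GrVec k G} {x y g : G} (h : x + y = g) {v : V.carrier} {w : W.carrier}
    (hv : v ∈ V.comp x) (hw : w ∈ W.comp y) : v ⊗ₜ[k] w ∈ tensorComp V W g :=
  h ▸ tmul_mem hv hw

theorem tensorComp_le {V W : GrVec k G} {g : G} {S : Submodule k (V.carrier ⊗[k] W.carrier)}
    (h : ∀ x y, x + y = g → ∀ v ∈ V.comp x, ∀ w ∈ W.comp y, v ⊗ₜ[k] w ∈ S) :
    tensorComp V W g ≤ S :=
  iSup_le fun x => iSup_le fun y => iSup_le fun hxy =>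
    Submodule.map₂_le.2 fun v hv w hw => h x y hxy v hv w hw

theorem ext_tmul {X : Type*} [AddCommMonoid X] [Module k X] (V W : GrVec k G)
    {f f' : V.carrier ⊗[k] W.carrier →ₗ[k] X}
    (h : ∀ x y, ∀ v ∈ V.comp x, ∀ w ∈ W.comp y, f (v ⊗ₜ w) = f' (v ⊗ₜ w)) : f = f' := by
  apply TensorProduct.ext
  apply V.ext_homog
  intro x v hv
  apply W.ext_homog
  intro y w hw
  exact h x y v hv w hw

/-- The tensor product of graded spaces, `(V ⊗ W)_g = ⊕_{x + y = g} V_x ⊗ W_y`. -/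
abbrev tensor (V W : GrVec k G) : GrVec k G where
  carrier := V.carrier ⊗[k] W.carrier
  comp := tensorComp V W
  isInternal := by
    refine isInternal_of_proj _
      (fun g => ∑ x, TensorProduct.map (V.proj x) (W.proj (g - x))) ?_ ?_ ?_
    · intro g t
      rw [LinearMap.sum_apply]
      refine Submodule.sum_mem _ fun x _ => ?_
      induction t with
      | zero => simp
      | add a b ha hb => rw [map_add]; exact Submodule.add_mem _ ha hb
      | tmul v w =>
        exact tmul_mem' (by abel) (V.proj_mem x v) (W.proj_mem (g - x) w)
    · intro t
      have : (∑ g, ∑ x, TensorProduct.map (V.proj x) (W.proj (g - x)) :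
          V.carrier ⊗[k] W.carrier →ₗ[k] V.carrier ⊗[k] W.carrier) = LinearMap.id := by
        apply ext_tmul
        intro x y v hv w hw
        simp only [LinearMap.sum_apply, TensorProduct.map_tmul, V.proj_of_mem _ hv,
          W.proj_of_mem _ hw, LinearMap.id_apply]
        rw [Finset.sum_eq_single (x + y), Finset.sum_eq_single x]
        · simp
        · intro b _ hb; simp [hb.symm]
        · simp
        · intro g _ hg
          refine Finset.sum_eq_zero fun b _ => ?_
          by_cases hb : x = b
          · subst hb
            have : y ≠ g - x := fun h => hg (by rw [h]; abel)
            simp [this]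
          · simp [hb]
        · simp
      simpa [LinearMap.sum_apply] using LinearMap.congr_fun this t
    · intro g t ht g'
      have : tensorComp V W g ≤ LinearMap.eqLocus
          (∑ x, TensorProduct.map (V.proj x) (W.proj (g' - x)))
          (if g = g' then LinearMap.id else 0) := by
        refine tensorComp_le ?_
        rintro x y rfl v hv w hw
        rw [LinearMap.mem_eqLocus]
        simp only [LinearMap.sum_apply, TensorProduct.map_tmul, V.proj_of_mem _ hv,
          W.proj_of_mem _ hw]
        rw [Finset.sum_eq_single x]
        · by_cases h : x + y = g'
          · have : y = g' - x := by rw [← h]; abel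
            simp [← this, h]
          · have : y ≠ g' - x := fun h' => h (by rw [h']; abel)
            simp [this, h]
        · intro b _ hb; simp [hb.symm]
        · simp
      have h := this ht
      rw [LinearMap.mem_eqLocus] at h
      rw [h]
      split_ifs <;> rfl

/-- The tensor product `f ⊗ f'` of morphisms. -/
def tensorMap {V V' W W' : GrVec k G} (f : V ⟶ V') (f' : W ⟶ W') : tensor V W ⟶ tensor V' W' :=
  ofLin (TensorProduct.map (lin f) (lin f')) fun g t ht => by
    have : tensorComp V W g ≤
        (tensorComp V' W' g).comap (TensorProduct.map (lin f) (lin f')) :=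
      tensorComp_le fun x y h v hv w hw => tmul_mem' h (lin_mem f hv) (lin_mem f' hw)
    exact this ht

@[simp] theorem lin_tensorMap {V V' W W' : GrVec k G} (f : V ⟶ V') (f' : W ⟶ W') :
    lin (tensorMap f f') = TensorProduct.map (lin f) (lin f') := rfl

/-- The tensor product bifunctor `⊗` of `Vec_G`. -/
def tensorFunctor (k : Type u) [Field k] (G : Type w) [DecidableEq G] [Fintype G]
    [AddCommGroup G] : GrVec k G ⥤ GrVec k G ⥤ GrVec k G where
  obj V :=
    { obj := fun W => tensor V W
      map := fun f => tensorMap (𝟙 V) f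
      map_id := fun W => hom_ext TensorProduct.map_id
      map_comp := fun f f' => hom_ext (TensorProduct.ext' fun _ _ => rfl) }
  map f :=
    { app := fun W => tensorMap f (𝟙 W)
      naturality := fun W W' f' => hom_ext (TensorProduct.ext' fun _ _ => rfl) }
  map_id V := by
    ext W : 2
    exact hom_ext TensorProduct.map_id
  map_comp f f' := by
    ext W : 2
    refine hom_ext ?_
    exact TensorProduct.ext' fun _ _ => rfl

/-- The unit object: `k` concentrated in degree `0`. -/
abbrev unit (k : Type u) [Field k] (G : Type w) [DecidableEq G] [Fintype G]
    [AddCommGroup G] : GrVec k G where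
  carrier := k
  comp g := if g = 0 then ⊤ else ⊥
  isInternal := by
    refine isInternal_of_proj _ (fun g => if g = 0 then LinearMap.id else 0) ?_ ?_ ?_
    · intro g v
      by_cases h : g = 0 <;> simp [h]
    · intro v
      rw [Finset.sum_eq_single 0]
      · simp
      · intro b _ hb; simp [hb]
      · simp
    · intro g v hv g'
      by_cases h : g = 0
      · subst h
        by_cases h' : g' = 0
        · simp [h']
        · simp [h', Ne.symm h']
      · simp only [h, if_false, Submodule.mem_bot] at hv
        subst hv; simp

theorem mem_unit {g : G} {c : k} (hc : c ∈ (unit k G).comp g) : g = 0 ∨ c = 0 := by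
  by_cases h : g = 0
  · exact Or.inl h
  · right
    have : c ∈ (if g = 0 then ⊤ else ⊥ : Submodule k k) := hc
    simpa [h] using this

theorem mem_unit_zero (c : k) : c ∈ (unit k G).comp 0 := by
  change c ∈ (if (0 : G) = 0 then ⊤ else ⊥ : Submodule k k)
  simp

end Tensor

end GrVec

/-- A normalized 3-cocycle on `G` (written additively) with coefficients in `k^*`. -/
structure ThreeCocycle (k : Type u) [Field k] (G : Type w) [AddCommGroup G] where
  toFun : G → G → G → kˣ
  cocycle : ∀ x y z t, toFun y z t * toFun x (y + z) t * toFun x y z =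
    toFun (x + y) z t * toFun x y (z + t)
  normalized : ∀ x y z, x = 0 ∨ y = 0 ∨ z = 0 → toFun x y z = 1

/-- A quasi-bicharacter with respect to the normalized 3-cocycle `Φ`. -/
structure QuasiBicharacter {k : Type u} [Field k] {G : Type w} [AddCommGroup G]
    (Φ : ThreeCocycle k G) where
  toFun : G → G → kˣ
  add_left : ∀ x y z, toFun (x + y) z =
    Φ.toFun z x y * toFun x z * (Φ.toFun x z y)⁻¹ * toFun y z * Φ.toFun x y z
  add_right : ∀ x y z, toFun x (y + z) =
    (Φ.toFun y z x)⁻¹ * toFun x z * Φ.toFun y x z * toFun x y * (Φ.toFun x y z)⁻¹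

section Monoidal

variable {k : Type u} [Field k] {G : Type w} [DecidableEq G] [Fintype G] [AddCommGroup G]

namespace GrVec

/-- The linear map `(V ⊗ W) ⊗ U → V ⊗ (W ⊗ U)` sending `(v ⊗ w) ⊗ u` to
`c x y z • v ⊗ (w ⊗ u)` for `v`, `w`, `u` homogeneous of degrees `x`, `y`, `z`. -/
def assocLin (c : G → G → G → kˣ) (V W U : GrVec k G) :
    (V.carrier ⊗[k] W.carrier) ⊗[k] U.carrier →ₗ[k] V.carrier ⊗[k] (W.carrier ⊗[k] U.carrier) :=
  ∑ x, ∑ y, ∑ z, (c x y z : k) •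
    ((TensorProduct.assoc k V.carrier W.carrier U.carrier).toLinearMap ∘ₗ
      TensorProduct.map (TensorProduct.map (V.proj x) (W.proj y)) (U.proj z))

/-- The linear map `V ⊗ (W ⊗ U) → (V ⊗ W) ⊗ U` sending `v ⊗ (w ⊗ u)` to
`(c x y z)⁻¹ • (v ⊗ w) ⊗ u` for `v`, `w`, `u` homogeneous of degrees `x`, `y`, `z`. -/
def assocInvLin (c : G → G → G → kˣ) (V W U : GrVec k G) :
    V.carrier ⊗[k] (W.carrier ⊗[k] U.carrier) →ₗ[k] (V.carrier ⊗[k] W.carrier) ⊗[k] U.carrier :=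
  ∑ x, ∑ y, ∑ z, ((c x y z)⁻¹ : k) •
    ((TensorProduct.assoc k V.carrier W.carrier U.carrier).symm.toLinearMap ∘ₗ
      TensorProduct.map (V.proj x) (TensorProduct.map (W.proj y) (U.proj z)))

/-- The linear map `V ⊗ W → W ⊗ V` sending `v ⊗ w` to `r x y • w ⊗ v` for `v`, `w`
homogeneous of degrees `x`, `y`. -/
def braidLin (r : G → G → kˣ) (V W : GrVec k G) :
    V.carrier ⊗[k] W.carrier →ₗ[k] W.carrier ⊗[k] V.carrier :=
  ∑ x, ∑ y, (r x y : k) •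
    ((TensorProduct.comm k V.carrier W.carrier).toLinearMap ∘ₗ
      TensorProduct.map (V.proj x) (W.proj y))

variable {V W U T : GrVec k G} {x y z t : G}
  {v : V.carrier} {w : W.carrier} {u : U.carrier} {s : T.carrier}

theorem assocLin_tmul (c : G → G → G → kˣ)
    (hv : v ∈ V.comp x) (hw : w ∈ W.comp y) (hu : u ∈ U.comp z) :
    assocLin c V W U ((v ⊗ₜ w) ⊗ₜ u) = (c x y z : k) • (v ⊗ₜ (w ⊗ₜ u)) := by
  simp only [assocLin, LinearMap.sum_apply, LinearMap.smul_apply, LinearMap.comp_apply,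
    TensorProduct.map_tmul, V.proj_of_mem _ hv, W.proj_of_mem _ hw, U.proj_of_mem _ hu]
  rw [Finset.sum_eq_single x, Finset.sum_eq_single y, Finset.sum_eq_single z]
  · simp
  · intro b _ hb; simp [hb.symm]
  · simp
  · intro b _ hb; simp [hb.symm]
  · simp
  · intro b _ hb; simp [hb.symm]
  · simp

theorem assocInvLin_tmul (c : G → G → G → kˣ)
    (hv : v ∈ V.comp x) (hw : w ∈ W.comp y) (hu : u ∈ U.comp z) :
    assocInvLin c V W U (v ⊗ₜ (w ⊗ₜ u)) = ((c x y z)⁻¹ : k) • ((v ⊗ₜ w) ⊗ₜ u) := by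
  simp only [assocInvLin, LinearMap.sum_apply, LinearMap.smul_apply, LinearMap.comp_apply,
    TensorProduct.map_tmul, V.proj_of_mem _ hv, W.proj_of_mem _ hw, U.proj_of_mem _ hu]
  rw [Finset.sum_eq_single x, Finset.sum_eq_single y, Finset.sum_eq_single z]
  · simp
  · intro b _ hb; simp [hb.symm]
  · simp
  · intro b _ hb; simp [hb.symm]
  · simp
  · intro b _ hb; simp [hb.symm]
  · simp

theorem braidLin_tmul (r : G → G → kˣ) (hv : v ∈ V.comp x) (hw : w ∈ W.comp y) :
    braidLin r V W (v ⊗ₜ w) = (r x y : k) • (w ⊗ₜ v) := by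
  simp only [braidLin, LinearMap.sum_apply, LinearMap.smul_apply, LinearMap.comp_apply,
    TensorProduct.map_tmul, V.proj_of_mem _ hv, W.proj_of_mem _ hw]
  rw [Finset.sum_eq_single x, Finset.sum_eq_single y]
  · simp
  · intro b _ hb; simp [hb.symm]
  · simp
  · intro b _ hb; simp [hb.symm]
  · simp

/-- Maps out of `(V ⊗ W) ⊗ U` are determined by homogeneous tensors. -/
theorem ext_tmul₃ {X : Type*} [AddCommMonoid X] [Module k X] (V W U : GrVec k G)
    {f f' : (V.carrier ⊗[k] W.carrier) ⊗[k] U.carrier →ₗ[k] X}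
    (h : ∀ x y z, ∀ v ∈ V.comp x, ∀ w ∈ W.comp y, ∀ u ∈ U.comp z,
      f ((v ⊗ₜ w) ⊗ₜ u) = f' ((v ⊗ₜ w) ⊗ₜ u)) : f = f' := by
  apply TensorProduct.ext
  apply ext_tmul
  intro x y v hv w hw
  apply U.ext_homog
  intro z u hu
  exact h x y z v hv w hw u hu

/-- Maps out of `V ⊗ (W ⊗ U)` are determined by homogeneous tensors. -/
theorem ext_tmul₃' {X : Type*} [AddCommMonoid X] [Module k X] (V W U : GrVec k G)
    {f f' : V.carrier ⊗[k] (W.carrier ⊗[k] U.carrier) →ₗ[k] X}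
    (h : ∀ x y z, ∀ v ∈ V.comp x, ∀ w ∈ W.comp y, ∀ u ∈ U.comp z,
      f (v ⊗ₜ (w ⊗ₜ u)) = f' (v ⊗ₜ (w ⊗ₜ u))) : f = f' := by
  apply TensorProduct.ext
  apply V.ext_homog
  intro x v hv
  apply ext_tmul
  intro y z w hw u hu
  exact h x y z v hv w hw u hu

/-- The associativity constraint twisted by `c`. -/
def assocIso (c : G → G → G → kˣ) (V W U : GrVec k G) :
    tensor (tensor V W) U ≅ tensor V (tensor W U) where
  hom := ofLin (assocLin c V W U) fun g p hp => by
    have h1 : ∀ x y z, ∀ v ∈ V.comp x, ∀ w ∈ W.comp y, ∀ u ∈ U.comp z,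
        assocLin c V W U ((v ⊗ₜ w) ⊗ₜ u) ∈ (tensor V (tensor W U)).comp (x + y + z) := by
      intro x y z v hv w hw u hu
      rw [assocLin_tmul c hv hw hu]
      exact Submodule.smul_mem _ _ (tmul_mem' (V := V) (W := tensor W U) (add_assoc x y z).symm hv
        (tmul_mem hw hu))
    have : tensorComp (tensor V W) U g ≤
        ((tensor V (tensor W U)).comp g).comap (assocLin c V W U) := by
      refine tensorComp_le ?_
      rintro x z rfl p hp u hu
      have h2 : tensorComp V W x ≤ ((tensor V (tensor W U)).comp (x + z)).comap
          (assocLin c V W U ∘ₗ (TensorProduct.mk k _ U.carrier).flip u) := by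
        refine tensorComp_le ?_
        rintro x y rfl v hv w hw
        exact h1 x y z v hv w hw u hu
      exact h2 hp
    exact this hp
  inv := ofLin (assocInvLin c V W U) fun g p hp => by
    have h1 : ∀ x y z, ∀ v ∈ V.comp x, ∀ w ∈ W.comp y, ∀ u ∈ U.comp z,
        assocInvLin c V W U (v ⊗ₜ (w ⊗ₜ u)) ∈ (tensor (tensor V W) U).comp (x + (y + z)) := by
      intro x y z v hv w hw u hu
      rw [assocInvLin_tmul c hv hw hu]
      exact Submodule.smul_mem _ _ (tmul_mem' (V := tensor V W) (W := U) (add_assoc x y z)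
        (tmul_mem hv hw) hu)
    have : tensorComp V (tensor W U) g ≤
        ((tensor (tensor V W) U).comp g).comap (assocInvLin c V W U) := by
      refine tensorComp_le ?_
      rintro x z rfl v hv p hp
      have h2 : tensorComp W U z ≤ ((tensor (tensor V W) U).comp (x + z)).comap
          (assocInvLin c V W U ∘ₗ TensorProduct.mk k V.carrier _ v) := by
        refine tensorComp_le ?_
        rintro y z rfl w hw u hu
        exact h1 x y z v hv w hw u hu
      exact h2 hp
    exact this hp
  hom_inv_id := by
    refine hom_ext (ext_tmul₃ V W U ?_)
    intro x y z v hv w hw u hu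
    simp [assocLin_tmul c hv hw hu, assocInvLin_tmul c hv hw hu]
  inv_hom_id := by
    refine hom_ext (ext_tmul₃' V W U ?_)
    intro x y z v hv w hw u hu
    simp [assocLin_tmul c hv hw hu, assocInvLin_tmul c hv hw hu]

/-- The usual isomorphism `k ⊗ V ≅ V`. -/
def leftUnitIso (V : GrVec k G) : tensor (unit k G) V ≅ V where
  hom := ofLin (TensorProduct.lid k V.carrier).toLinearMap fun g p hp => by
    have : tensorComp (unit k G) V g ≤
        (V.comp g).comap (TensorProduct.lid k V.carrier).toLinearMap := by
      refine tensorComp_le ?_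
      rintro x y rfl c hc v hv
      rcases mem_unit hc with rfl | rfl
      · simpa using Submodule.smul_mem _ _ hv
      · simp
    exact this hp
  inv := ofLin (TensorProduct.lid k V.carrier).symm.toLinearMap fun g v hv =>
    tmul_mem' (V := unit k G) (W := V) (zero_add g) (mem_unit_zero 1) hv
  hom_inv_id := hom_ext (LinearMap.ext fun v =>
    (TensorProduct.lid k V.carrier).symm_apply_apply v)
  inv_hom_id := hom_ext (LinearMap.ext fun v =>
    (TensorProduct.lid k V.carrier).apply_symm_apply v)

/-- The usual isomorphism `V ⊗ k ≅ V`. -/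
def rightUnitIso (V : GrVec k G) : tensor V (unit k G) ≅ V where
  hom := ofLin (TensorProduct.rid k V.carrier).toLinearMap fun g p hp => by
    have : tensorComp V (unit k G) g ≤
        (V.comp g).comap (TensorProduct.rid k V.carrier).toLinearMap := by
      refine tensorComp_le ?_
      rintro x y rfl v hv c hc
      rcases mem_unit hc with rfl | rfl
      · simpa using Submodule.smul_mem _ _ hv
      · simp
    exact this hp
  inv := ofLin (TensorProduct.rid k V.carrier).symm.toLinearMap fun g v hv =>
    tmul_mem' (V := V) (W := unit k G) (add_zero g) hv (mem_unit_zero 1)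
  hom_inv_id := hom_ext (LinearMap.ext fun v =>
    (TensorProduct.rid k V.carrier).symm_apply_apply v)
  inv_hom_id := hom_ext (LinearMap.ext fun v =>
    (TensorProduct.rid k V.carrier).apply_symm_apply v)

/-- The commutativity constraint given by `r`. -/
def braidIso (r : G → G → kˣ) (V W : GrVec k G) : tensor V W ≅ tensor W V where
  hom := ofLin (braidLin r V W) fun g p hp => by
    have : tensorComp V W g ≤ ((tensor W V).comp g).comap (braidLin r V W) := by
      refine tensorComp_le ?_
      rintro x y rfl v hv w hw
      rw [Submodule.mem_comap, braidLin_tmul r hv hw]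
      exact Submodule.smul_mem _ _ (tmul_mem' (add_comm y x) hw hv)
    exact this hp
  inv := ofLin (braidLin (fun x y => (r y x)⁻¹) W V) fun g p hp => by
    have : tensorComp W V g ≤
        ((tensor V W).comp g).comap (braidLin (fun x y => (r y x)⁻¹) W V) := by
      refine tensorComp_le ?_
      rintro x y rfl v hv w hw
      rw [Submodule.mem_comap, braidLin_tmul _ hv hw]
      exact Submodule.smul_mem _ _ (tmul_mem' (add_comm y x) hw hv)
    exact this hp
  hom_inv_id := by
    refine hom_ext (ext_tmul V W ?_)
    intro x y v hv w hw
    simp [braidLin_tmul _ hv hw, braidLin_tmul _ hw hv]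
  inv_hom_id := by
    refine hom_ext (ext_tmul W V ?_)
    intro x y v hv w hw
    simp [braidLin_tmul _ hv hw, braidLin_tmul _ hw hv]

/-- The monoidal structure on `Vec_G` given by `Φ`: the graded tensor product with the associativity
constraint `(v ⊗ w) ⊗ u ↦ Φ(x, y, z) v ⊗ (w ⊗ u)` on homogeneous elements of degrees `x`, `y`, `z`
and with the usual unit constraints. -/
abbrev monoidalStruct (Φ : ThreeCocycle k G) : MonoidalCategoryStruct (GrVec k G) where
  tensorObj V W := tensor V W
  whiskerLeft V _ _ f := tensorMap (𝟙 V) f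
  whiskerRight f W := tensorMap f (𝟙 W)
  tensorHom f f' := tensorMap f f'
  tensorUnit := unit k G
  associator V W U := assocIso Φ.toFun V W U
  leftUnitor V := leftUnitIso V
  rightUnitor V := rightUnitIso V


/-- The axioms of a monoidal category for `monoidalStruct Φ`. -/
abbrev monoidal (Φ : ThreeCocycle k G) : MonoidalCategory (GrVec k G) where
  toMonoidalCategoryStruct := monoidalStruct Φ
  tensorHom_def {V₁ W₁ V₂ W₂} f g := hom_ext
    (TensorProduct.ext' fun _ _ => rfl)
  id_tensorHom_id V W := hom_ext (TensorProduct.ext' fun _ _ => rfl)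
  tensorHom_comp_tensorHom _ _ _ _ := hom_ext
    (TensorProduct.ext' fun _ _ => rfl)
  whiskerLeft_id V W := hom_ext (TensorProduct.ext' fun _ _ => rfl)
  id_whiskerRight V W := hom_ext (TensorProduct.ext' fun _ _ => rfl)
  associator_naturality {V W U V' W' U'} f f' f'' := by
    refine hom_ext (ext_tmul₃ V W U ?_)
    intro x y z v hv w hw u hu
    change assocLin Φ.toFun V' W' U' ((lin f v ⊗ₜ lin f' w) ⊗ₜ lin f'' u) =
      TensorProduct.map (lin f) (TensorProduct.map (lin f') (lin f''))
        (assocLin Φ.toFun V W U ((v ⊗ₜ w) ⊗ₜ u))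
    rw [assocLin_tmul _ hv hw hu, assocLin_tmul _ (lin_mem f hv) (lin_mem f' hw) (lin_mem f'' hu),
      map_smul]
    rfl
  leftUnitor_naturality {V W} f := by
    refine hom_ext (TensorProduct.ext' fun c v => ?_)
    exact (map_smul (lin f) c v).symm
  rightUnitor_naturality {V W} f := by
    refine hom_ext (TensorProduct.ext' fun v c => ?_)
    exact (map_smul (lin f) c v).symm
  pentagon V W U T := by
    refine hom_ext (TensorProduct.ext (ext_tmul₃ V W U ?_))
    intro x y z v hv w hw u hu
    apply GrVec.ext_homog T
    intro t s hs
    change TensorProduct.map LinearMap.id (assocLin Φ.toFun W U T)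
        (assocLin Φ.toFun V (tensor W U) T
          (TensorProduct.map (assocLin Φ.toFun V W U) LinearMap.id (((v ⊗ₜ w) ⊗ₜ u) ⊗ₜ s))) =
      assocLin Φ.toFun V W (tensor U T)
        (assocLin Φ.toFun (tensor V W) U T (((v ⊗ₜ w) ⊗ₜ u) ⊗ₜ s))
    rw [TensorProduct.map_tmul, assocLin_tmul _ hv hw hu,
      assocLin_tmul (V := tensor V W) _ (tmul_mem hv hw) hu hs,
      LinearMap.id_apply, ← TensorProduct.smul_tmul', map_smul, map_smul, map_smul,
      assocLin_tmul (W := tensor W U) _ hv (tmul_mem hw hu) hs,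
      assocLin_tmul (U := tensor U T) _ hv hw (tmul_mem hu hs),
      map_smul, TensorProduct.map_tmul, LinearMap.id_apply, assocLin_tmul _ hw hu hs,
      TensorProduct.tmul_smul, smul_smul, smul_smul, smul_smul]
    congr 1
    have := congrArg Units.val (Φ.cocycle x y z t)
    simp only [Units.val_mul] at this
    rw [← this]; ring
  triangle V W := by
    refine hom_ext (TensorProduct.ext' ?_)
    intro p w
    refine LinearMap.congr_fun (f := _) (g := _) (x := p ⊗ₜ w)
      (ext_tmul₃ V (unit k G) W ?_)
    intro x y z v hv c hc w hw
    change TensorProduct.map LinearMap.id (TensorProduct.lid k _).toLinearMap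
        (assocLin Φ.toFun V (unit k G) W ((v ⊗ₜ c) ⊗ₜ w)) =
      TensorProduct.map (TensorProduct.rid k _).toLinearMap LinearMap.id ((v ⊗ₜ c) ⊗ₜ w)
    rw [assocLin_tmul _ hv hc hw]
    rcases mem_unit hc with rfl | rfl
    · rw [Φ.normalized x 0 z (Or.inr (Or.inl rfl))]
      simp [TensorProduct.smul_tmul]
    · simp

/-- The braiding `v ⊗ w ↦ R(x, y) w ⊗ v` on homogeneous elements of degrees `x`, `y`. -/
abbrev braided {Φ : ThreeCocycle k G} (R : QuasiBicharacter Φ) :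
    @BraidedCategory (GrVec k G) _ (monoidal Φ) :=
  letI := monoidal Φ
  { braiding V W := braidIso R.toFun V W
    braiding_naturality_right V W W' f := by
      refine hom_ext (ext_tmul V W ?_)
      intro x y v hv w hw
      change braidLin R.toFun V W' (v ⊗ₜ lin f w) =
        TensorProduct.map (lin f) LinearMap.id (braidLin R.toFun V W (v ⊗ₜ w))
      rw [braidLin_tmul _ hv hw, braidLin_tmul _ hv (lin_mem f hw), map_smul]
      rfl
    braiding_naturality_left {V V'} f W := by
      refine hom_ext (ext_tmul V W ?_)
      intro x y v hv w hw
      change braidLin R.toFun V' W (lin f v ⊗ₜ w) =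
        TensorProduct.map LinearMap.id (lin f) (braidLin R.toFun V W (v ⊗ₜ w))
      rw [braidLin_tmul _ hv hw, braidLin_tmul _ (lin_mem f hv) hw, map_smul]
      rfl
    hexagon_forward V W U := by
      refine hom_ext (ext_tmul₃ V W U ?_)
      intro x y z v hv w hw u hu
      change assocLin Φ.toFun W U V (braidLin R.toFun V (tensor W U)
          (assocLin Φ.toFun V W U ((v ⊗ₜ w) ⊗ₜ u))) =
        TensorProduct.map LinearMap.id (braidLin R.toFun V U) (assocLin Φ.toFun W V U
          (TensorProduct.map (braidLin R.toFun V W) LinearMap.id ((v ⊗ₜ w) ⊗ₜ u)))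
      rw [TensorProduct.map_tmul, braidLin_tmul _ hv hw, assocLin_tmul _ hv hw hu,
        ← TensorProduct.smul_tmul', map_smul, map_smul, map_smul, map_smul,
        braidLin_tmul (W := tensor W U) _ hv (tmul_mem hw hu), map_smul,
        assocLin_tmul _ hw hu hv, LinearMap.id_apply, assocLin_tmul _ hw hv hu, map_smul,
        TensorProduct.map_tmul, braidLin_tmul _ hv hu, LinearMap.id_apply,
        TensorProduct.tmul_smul, smul_smul, smul_smul, smul_smul, smul_smul]
      congr 1
      norm_cast
      rw [R.add_right]
      simp only [← mul_assoc]
      apply Units.ext; push_cast; field_simp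
    hexagon_reverse V W U := by
      refine hom_ext (ext_tmul₃' V W U ?_)
      intro x y z v hv w hw u hu
      change assocInvLin Φ.toFun U V W (braidLin R.toFun (tensor V W) U
          (assocInvLin Φ.toFun V W U (v ⊗ₜ (w ⊗ₜ u)))) =
        TensorProduct.map (braidLin R.toFun V U) LinearMap.id (assocInvLin Φ.toFun V U W
          (TensorProduct.map LinearMap.id (braidLin R.toFun W U) (v ⊗ₜ (w ⊗ₜ u))))
      rw [TensorProduct.map_tmul, braidLin_tmul _ hw hu, assocInvLin_tmul _ hv hw hu,
        TensorProduct.tmul_smul, map_smul, map_smul, map_smul, map_smul,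
        braidLin_tmul (V := tensor V W) _ (tmul_mem hv hw) hu, map_smul,
        assocInvLin_tmul _ hu hv hw, LinearMap.id_apply, assocInvLin_tmul _ hv hu hw, map_smul,
        TensorProduct.map_tmul, braidLin_tmul _ hv hu, LinearMap.id_apply,
        ← TensorProduct.smul_tmul', smul_smul, smul_smul, smul_smul, smul_smul]
      congr 1
      norm_cast
      rw [R.add_left]
      apply Units.ext; push_cast; field_simp }

end GrVec

/-- The category `Vec_G^Φ`: the category `Vec_G` with the graded tensor product and with the
associativity constraint `(v ⊗ w) ⊗ u ↦ Φ(x, y, z) v ⊗ (w ⊗ u)` on homogeneous elements of degrees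
`x`, `y`, `z`. -/
def GrVecTw {k : Type u} [Field k] {G : Type w} [DecidableEq G] [AddCommGroup G]
    (_Φ : ThreeCocycle k G) := GrVec k G

namespace GrVecTw

open GrVec

variable (Φ : ThreeCocycle k G)

instance : Category (GrVecTw Φ) := inferInstanceAs (Category (GrVec k G))
instance : Preadditive (GrVecTw Φ) := inferInstanceAs (Preadditive (GrVec k G))
instance : Linear k (GrVecTw Φ) := inferInstanceAs (Linear k (GrVec k G))

instance : MonoidalCategory (GrVecTw Φ) := GrVec.monoidal Φ

end GrVecTw

/-- The braided monoidal category `(Vec_G^Φ, R)`: the monoidal category `Vec_G^Φ` with the braiding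
`v ⊗ w ↦ R(x, y) w ⊗ v` on homogeneous elements of degrees `x`, `y`. -/
def GrVecBr {k : Type u} [Field k] {G : Type w} [DecidableEq G] [AddCommGroup G]
    {Φ : ThreeCocycle k G} (_R : QuasiBicharacter Φ) := GrVecTw Φ

namespace GrVecBr

open GrVec

variable {Φ : ThreeCocycle k G} (R : QuasiBicharacter Φ)

instance : Category (GrVecBr R) := inferInstanceAs (Category (GrVecTw Φ))
instance : Preadditive (GrVecBr R) := inferInstanceAs (Preadditive (GrVecTw Φ))
instance : Linear k (GrVecBr R) := inferInstanceAs (Linear k (GrVecTw Φ))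
instance : MonoidalCategory (GrVecBr R) := inferInstanceAs (MonoidalCategory (GrVecTw Φ))

instance : BraidedCategory (GrVecBr R) := GrVec.braided R

end GrVecBr

end Monoidal

/-- Two `k`-linear braided monoidal categories are tensor equivalent if there is a `k`-linear
equivalence of categories between them that is a (strong) braided monoidal functor. -/
def TensorEquivalent (k : Type*) [Field k] (C D : Type*) [Category C] [Preadditive C] [Linear k C]
    [MonoidalCategory C] [BraidedCategory C] [Category D] [Preadditive D] [Linear k D]
    [MonoidalCategory D] [BraidedCategory D] : Prop :=
  ∃ (F : C ⥤ D) (_ : F.Braided), F.IsEquivalence ∧ F.Additive ∧ F.Linear k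

section TwoCyclic

variable {k : Type u} [Field k] {m n : ℕ} [NeZero m] [NeZero n]

/-- `[(i + j) / m]` for the representatives `0 ≤ i, j < m` of two elements of `ℤ/m`. -/
def carry (x y : ZMod m) : ℕ := (x.val + y.val) / m

theorem carry_comm (x y : ZMod m) : carry x y = carry y x := by
  rw [carry, carry, add_comm]

theorem val_add_carry (x y : ZMod m) : (x + y).val + m * carry x y = x.val + y.val := by
  rw [ZMod.val_add, carry, Nat.mod_add_div]

theorem carry_assoc (x y z : ZMod m) :
    carry x y + carry (x + y) z = carry y z + carry x (y + z) := by
  have h1 := val_add_carry x y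
  have h2 := val_add_carry (x + y) z
  have h3 := val_add_carry y z
  have h4 := val_add_carry x (y + z)
  rw [← add_assoc] at h4
  have : m * (carry x y + carry (x + y) z) = m * (carry y z + carry x (y + z)) := by
    rw [mul_add, mul_add]; omega
  exact Nat.eq_of_mul_eq_mul_left (Nat.pos_of_neZero m) this

theorem carry_zero_left (x : ZMod m) : carry 0 x = 0 := by
  simp [carry, Nat.div_eq_of_lt (ZMod.val_lt x)]

theorem carry_zero_right (x : ZMod m) : carry x 0 = 0 := by
  rw [carry_comm, carry_zero_left]

theorem pow_val_add {ζ : kˣ} (hζ : ζ ^ m = 1) (e : ℕ) (x y : ZMod m) :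
    ζ ^ (e * (x + y).val) = ζ ^ (e * x.val) * ζ ^ (e * y.val) := by
  rw [← pow_add, ← mul_add, ← val_add_carry x y, mul_add, pow_add,
    show e * (m * carry x y) = m * (e * carry x y) by ring, pow_mul ζ m, hζ, one_pow, mul_one]

/-- The 3-cocycle `Φ_{a,b,d}` on `ℤ/m × ℤ/n`, where `(i, j)` stands for `g₁^i g₂^j`. -/
def cocycleABD (ζm ζn : kˣ) (hm : ζm ^ m = 1) (hn : ζn ^ n = 1) (a b d : ℕ) :
    ThreeCocycle k (ZMod m × ZMod n) where
  toFun x y z :=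
    ζm ^ (a * carry z.1 y.1 * x.1.val) * ζn ^ (b * carry z.1 y.1 * x.2.val) *
      ζn ^ (d * carry y.2 z.2 * x.2.val)
  cocycle x y z t := by
    have key : ∀ {p q : ℕ} [NeZero p] [NeZero q] {ζ : kˣ} (_ : ζ ^ q = 1) (e : ℕ)
        (x y' : ZMod q) (y z t : ZMod p),
        ζ ^ (e * carry z t * y'.val) * ζ ^ (e * carry (y + z) t * x.val) *
          ζ ^ (e * carry y z * x.val) =
        ζ ^ (e * carry z t * (x + y').val) * ζ ^ (e * carry y (z + t) * x.val) := by
      intro p q _ _ ζ hζ e x y' y z t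
      rw [pow_val_add hζ]
      simp only [← pow_add]
      congr 1
      have := carry_assoc y z t
      have h2 : e * x.val * (carry y z + carry (y + z) t) =
        e * x.val * (carry z t + carry y (z + t)) := by rw [this]
      linarith
    have h1 := key hm a x.1 y.1 y.1 z.1 t.1
    have h2 := key hn b x.2 y.2 y.1 z.1 t.1
    have h3 := key hn d x.2 y.2 y.2 z.2 t.2
    simp only [Prod.fst_add, Prod.snd_add]
    rw [carry_comm t.1 z.1, carry_comm t.1 (y.1 + z.1), carry_comm z.1 y.1,
      carry_comm (z.1 + t.1) y.1]
    calc _ = _ := by ac_rfl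
      _ = _ := congrArg₂ (· * ·) (congrArg₂ (· * ·) h1 h2) h3
      _ = _ := by ac_rfl
  normalized x y z h := by
    rcases h with rfl | rfl | rfl <;> simp [carry_zero_left, carry_zero_right]

/-- The set `A_{a,b,d}` of the `(r₁₁, r₁₂, r₂₁, r₂₂)` that satisfy
`r₁₁^m = ζ_m^a = ζ_m^(-a)`, `r₂₂^n = ζ_n^d = ζ_n^(-d)`, `r₁₂^n = 1`, `r₁₂^m = ζ_n^(-b)`,
`r₂₁^n = 1` and `r₂₁^m = ζ_n^b`. -/
structure ParamABD (m n : ℕ) (ζm ζn : kˣ) (a b d : ℕ) where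
  r11 : kˣ
  r12 : kˣ
  r21 : kˣ
  r22 : kˣ
  r11_pow : r11 ^ m = ζm ^ a
  r11_pow' : r11 ^ m = (ζm ^ a)⁻¹
  r22_pow : r22 ^ n = ζn ^ d
  r22_pow' : r22 ^ n = (ζn ^ d)⁻¹
  r12_pow_n : r12 ^ n = 1
  r12_pow_m : r12 ^ m = (ζn ^ b)⁻¹
  r21_pow_n : r21 ^ n = 1
  r21_pow_m : r21 ^ m = ζn ^ b

theorem pow_val_add_mul {r c : kˣ} (h : r ^ m = c) (x y : ZMod m) (t : ℕ) :
    r ^ ((x + y).val * t) = r ^ (x.val * t) * r ^ (y.val * t) * (c ^ (carry x y * t))⁻¹ := by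
  rw [eq_mul_inv_iff_mul_eq, ← h, ← pow_mul, ← pow_add, ← pow_add, ← mul_assoc, ← add_mul,
    ← add_mul, val_add_carry]

/-- The quasi-bicharacter `R_r`,
`R_r(g₁^i g₂^j, g₁^s g₂^t) = r₁₁^(is) r₁₂^(it) r₂₁^(js) r₂₂^(jt)` for `0 ≤ i, s < m` and
`0 ≤ j, t < n`. -/
def quasiBicharacterABD (ζm ζn : kˣ) (hm : ζm ^ m = 1) (hn : ζn ^ n = 1) (a b d : ℕ)
    (r : ParamABD m n ζm ζn a b d) : QuasiBicharacter (cocycleABD ζm ζn hm hn a b d) where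
  toFun x y :=
    r.r11 ^ (x.1.val * y.1.val) * r.r12 ^ (x.1.val * y.2.val) *
      r.r21 ^ (x.2.val * y.1.val) * r.r22 ^ (x.2.val * y.2.val)
  add_left x y z := by
    have h11 := pow_val_add_mul r.r11_pow' x.1 y.1 z.1.val
    have h12 := pow_val_add_mul r.r12_pow_m x.1 y.1 z.2.val
    have h21 := pow_val_add_mul r.r21_pow_n x.2 y.2 z.1.val
    have h22 := pow_val_add_mul r.r22_pow' x.2 y.2 z.2.val
    simp only [Prod.fst_add, Prod.snd_add, h11, h12, h21, h22, cocycleABD, inv_pow, inv_inv,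
      one_pow, inv_one, mul_one, ← pow_mul, mul_assoc, carry_comm z.1 y.1, carry_comm y.1 x.1,
      carry_comm z.2 y.2]
    apply Units.ext; push_cast; field_simp
  add_right x y z := by
    have h11 := pow_val_add_mul r.r11_pow y.1 z.1 x.1.val
    have h21 := pow_val_add_mul r.r21_pow_m y.1 z.1 x.2.val
    have h12 := pow_val_add_mul r.r12_pow_n y.2 z.2 x.1.val
    have h22 := pow_val_add_mul r.r22_pow y.2 z.2 x.2.val
    simp only [Prod.fst_add, Prod.snd_add, mul_comm x.1.val ((y.1 + z.1).val),
      mul_comm x.1.val ((y.2 + z.2).val), mul_comm x.2.val ((y.1 + z.1).val),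
      mul_comm x.2.val ((y.2 + z.2).val), h11, h12, h21, h22, cocycleABD,
      one_pow, inv_one, mul_one, ← pow_mul, mul_assoc, carry_comm z.1 y.1, carry_comm x.1 z.1,
      carry_comm z.2 x.2]
    apply Units.ext; push_cast; field_simp
    ring

end TwoCyclic

end

/-! ### Abelian 3-cocycles and their coboundaries -/

noncomputable section

/-! Transport along the given natural isomorphism makes the tensor product literally the graded one.
Naturality against maps out of one-dimensional objects then forces the associator and the braiding
to act on homogeneous tensors by scalars ω(x,y,z) and c(x,y). The pentagon and the hexagons say that
(ω,c) is an abelian 3-cocycle with values in k^*. If (ω,c) is cohomologous to (Φ,R) through a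
cochain h, the identity functor with tensorator rescaled by h is a tensor equivalence
(`tensorEquivalent_of_cohomologous`), so the theorem becomes a statement about abelian cohomology.

Following Eilenberg and Mac Lane, the class of (ω,c) is detected by the quadratic function x ↦
c(x,x), which on two generators amounts to the values c(g₁,g₁), c(g₂,g₂) and c(g₁,g₂)c(g₂,g₁). Take
these as r₁₁, r₂₂, r₂₁ and put r₁₂ = 1. The relations mg₁ = 0 and ng₂ = 0 place r in A_{a,0,d}, so b
= 0 always suffices. The pair (Φ_{a,0,d}, R_r) has the same three values, and it remains to see that
a cocycle for which all three are trivial is a coboundary (`exists_trivialization_zmod_prod`).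

For this, pull back to ℕ × ℕ, where induction is available. Along each generator ω is a coboundary
by summation, and the coherence of the interchange (`interchange_assoc`) glues the two directions.
The corrected braiding is biadditive, hence of the form χ(x₁y₂ - x₂y₁), and a biadditive cochain
removes it. Finally `exists_trivialization_of_fibration` descends the result: on the kernel mℕ × nℕ
the trivializing cochain is a symmetric 2-cocycle, hence a coboundary, and a 1-cochain built from
its primitive makes the trivialization constant along the fibres. -/

/-- The pentagon and hexagon equations for an associativity function `ω` and a braiding function
`c` with values in an additive group (an abelian 3-cocycle in the sense of Eilenberg–Mac Lane). -/
structure IsAbelianCocycle {G A : Type*} [AddCommMonoid G] [AddCommGroup A]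
    (ω : G → G → G → A) (c : G → G → A) : Prop where
  pentagon : ∀ x y z t, ω y z t + ω x (y + z) t + ω x y z = ω (x + y) z t + ω x y (z + t)
  hexagon_left : ∀ x y z, c (x + y) z = ω z x y + c x z - ω x z y + c y z + ω x y z
  hexagon_right : ∀ x y z, c x (y + z) = -ω y z x + c x z + ω y x z + c x y - ω x y z

/-- The additive coboundary of a 2-cochain. -/
def cochainD {G A : Type*} [AddCommMonoid G] [AddCommGroup A] (h : G → G → A) (x y z : G) : A :=
  h y z + h x (y + z) - h (x + y) z - h x y

/-- `h` trivializes the abelian 3-cocycle `(ω, c)`. -/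
structure IsTrivialization {G A : Type*} [AddCommMonoid G] [AddCommGroup A]
    (ω : G → G → G → A) (c : G → G → A) (h : G → G → A) : Prop where
  assoc : ∀ x y z, ω x y z = cochainD h x y z
  braid : ∀ x y, c x y = h y x - h x y

namespace IsAbelianCocycle

variable {G A : Type*} [AddCommGroup A]

section Monoid

variable [AddCommMonoid G] {ω ω' : G → G → G → A} {c c' : G → G → A}

theorem sub (H : IsAbelianCocycle ω c) (H' : IsAbelianCocycle ω' c') :
    IsAbelianCocycle (fun x y z => ω x y z - ω' x y z) (fun x y => c x y - c' x y) where
  pentagon x y z t := by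
    linear_combination (norm := abel) H.pentagon x y z t - H'.pentagon x y z t
  hexagon_left x y z := by
    linear_combination (norm := abel) H.hexagon_left x y z - H'.hexagon_left x y z
  hexagon_right x y z := by
    linear_combination (norm := abel) H.hexagon_right x y z - H'.hexagon_right x y z

/-- Together with `sub`, this allows an abelian cocycle to be corrected by a cochain without leaving
the abelian cocycles. -/
theorem of_trivialization {h : G → G → A} (H : IsTrivialization ω c h) :
    IsAbelianCocycle ω c where
  pentagon x y z t := by
    simp only [H.assoc, cochainD, add_assoc]; abel
  hexagon_left x y z := by
    simp only [H.assoc, H.braid, cochainD, add_comm z x, add_comm z y]; abel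
  hexagon_right x y z := by
    simp only [H.assoc, H.braid, cochainD, add_comm x y, add_comm z x]; abel

/-- The pullback of an abelian cocycle along an additive map. -/
theorem comap {G' : Type*} [AddCommMonoid G'] (H : IsAbelianCocycle ω c) (f : G' →+ G) :
    IsAbelianCocycle (fun x y z => ω (f x) (f y) (f z)) (fun x y => c (f x) (f y)) where
  pentagon x y z t := by simpa only [map_add] using H.pentagon (f x) (f y) (f z) (f t)
  hexagon_left x y z := by simpa only [map_add] using H.hexagon_left (f x) (f y) (f z)
  hexagon_right x y z := by simpa only [map_add] using H.hexagon_right (f x) (f y) (f z)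

/-! ### The interchange and its coherence -/

/-- The scalar by which the interchange
`(a ⊗ b) ⊗ (d ⊗ e) → (a ⊗ d) ⊗ (b ⊗ e)` acts on homogeneous elements. -/
def interchange (ω : G → G → G → A) (c : G → G → A) (a b d e : G) : A :=
  ω a b (d + e) - ω b d e + c b d + ω d b e - ω a d (b + e)

/-- In a braided category the tensor product is itself a monoidal functor of two variables, with the
interchange as structure map; this is its associativity axiom. Hence ω on sums is ω on the first
summands plus ω on the second summands, up to the coboundary of the interchange. The coherence
diagram is filled by one hexagon of each kind and seventeen pentagons. -/
theorem interchange_assoc (H : IsAbelianCocycle ω c) (x₁ x₂ y₁ y₂ z₁ z₂ : G) :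
    interchange ω c x₁ x₂ y₁ y₂ + interchange ω c (x₁ + y₁) (x₂ + y₂) z₁ z₂ +
      ω x₁ y₁ z₁ + ω x₂ y₂ z₂ =
    ω (x₁ + x₂) (y₁ + y₂) (z₁ + z₂) + interchange ω c y₁ y₂ z₁ z₂ +
      interchange ω c x₁ x₂ (y₁ + z₁) (y₂ + z₂) := by
  have h1 := H.hexagon_left x₂ y₂ z₁
  have h2 := H.hexagon_right x₂ y₁ z₁
  have p1 := H.pentagon x₁ x₂ y₁ y₂
  have p2 := H.pentagon (x₁ + x₂) y₁ y₂ (z₁ + z₂)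
  have p3 := H.pentagon (x₁ + x₂ + y₁) y₂ z₁ z₂
  have p4 := H.pentagon x₁ y₁ x₂ y₂
  have p5 := H.pentagon (x₁ + y₁) x₂ y₂ z₁
  have p6 := H.pentagon (x₁ + y₁) (x₂ + y₂) z₁ z₂
  have p7 := H.pentagon x₁ x₂ y₁ z₁
  have p8 := H.pentagon x₁ x₂ (y₁ + z₁) (y₂ + z₂)
  have p9 := H.pentagon (x₁ + x₂) y₁ z₁ (y₂ + z₂)
  have p10 := H.pentagon (x₁ + x₂ + y₁) z₁ y₂ z₂
  have p11 := H.pentagon x₁ y₁ x₂ z₁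
  have p12 := H.pentagon (x₁ + y₁) x₂ z₁ y₂
  have p13 := H.pentagon x₁ y₁ z₁ x₂
  have p14 := H.pentagon x₁ (y₁ + z₁) x₂ (y₂ + z₂)
  have p15 := H.pentagon (x₁ + y₁) z₁ x₂ y₂
  have p16 := H.pentagon (x₁ + y₁) z₁ (x₂ + y₂) z₂
  have p17 := H.pentagon (x₁ + y₁ + z₁) x₂ y₂ z₂
  simp only [interchange]
  simp only [add_comm, add_left_comm] at h1 h2 p1 p2 p3 p4 p5 p6 p7 p8 p9 p10
  simp only [add_comm, add_left_comm, add_assoc] at p11 p12 p13 p14 p15 p16 p17 ⊢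
  linear_combination (norm := abel) h1 - h2 - p1 - p2 + p3 + p4 + p5 - p6 + p7 + p8 + p9 - p10 - p11
    - p12 + p13 - p14 + p15 + p16 + p17


/-! ### Normalization -/

theorem apply_zero_mid (H : IsAbelianCocycle ω c) (x y : G) :
    ω x 0 y = ω 0 0 y + ω x 0 0 := by
  have := H.pentagon x 0 0 y
  simp only [add_zero, zero_add] at this
  linear_combination (norm := abel) -this

/-- Vanishing in the middle slot is the only normalization that has to be arranged: the pentagon
propagates it to the outer slots, and the hexagons to the braiding. -/
theorem apply_zero_left (H : IsAbelianCocycle ω c) (hn : ∀ x y, ω x 0 y = 0) (x y : G) :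
    ω 0 x y = 0 := by
  have := H.pentagon 0 0 x y
  simp only [add_zero, zero_add, hn] at this
  simpa using this

theorem apply_zero_right (H : IsAbelianCocycle ω c) (hn : ∀ x y, ω x 0 y = 0) (x y : G) :
    ω x y 0 = 0 := by
  have := H.pentagon x y 0 0
  simp only [add_zero, hn, zero_add] at this
  simpa using this

theorem braid_zero_left (H : IsAbelianCocycle ω c) (hn : ∀ x y, ω x 0 y = 0) (x : G) :
    c 0 x = 0 := by
  have := H.hexagon_left 0 0 x
  simpa [hn, H.apply_zero_left hn, H.apply_zero_right hn] using this

theorem braid_zero_right (H : IsAbelianCocycle ω c) (hn : ∀ x y, ω x 0 y = 0) (x : G) :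
    c x 0 = 0 := by
  have := H.hexagon_right x 0 0
  simpa [hn, H.apply_zero_left hn, H.apply_zero_right hn] using this

/-- Every abelian cocycle becomes normalized after subtracting a coboundary. -/
theorem exists_normalized (H : IsAbelianCocycle ω c) : ∃ h : G → G → A,
    IsAbelianCocycle (fun x y z => ω x y z - cochainD h x y z)
      (fun x y => c x y - (h y x - h x y)) ∧ ∀ x y, ω x 0 y - cochainD h x 0 y = 0 := by
  -- The coboundary of this cochain at (x,0,y) is ω 0 0 y + ω x 0 0 - 2 ω 0 0 0. By `apply_zero_mid`
  -- this equals ω x 0 y, since the same identity at (0,0,0) gives ω 0 0 0 = 0.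
  refine ⟨fun x y => ω 0 0 y - ω x 0 0, H.sub (of_trivialization ⟨fun _ _ _ => rfl,
    fun _ _ => rfl⟩), fun x y => ?_⟩
  have h0 := H.apply_zero_mid 0 0
  simp only [cochainD, zero_add, add_zero]
  linear_combination (norm := abel) H.apply_zero_mid x y - h0 - h0

/-! ### Trivializing the associativity function on two generators -/

/-- On multiples of a single element the associativity function is a coboundary. -/
theorem exists_cochain_nsmul (H : IsAbelianCocycle ω c) (hn : ∀ x y, ω x 0 y = 0) (g : G) :
    ∃ h : ℕ → ℕ → A, ∀ i j l : ℕ, ω (i • g) (j • g) (l • g) = cochainD h i j l := by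
  -- The sum is the cost of rebracketing i•g + j•g when the second summand is built up by adding g
  -- on the right one copy at a time. The pentagon with last entry g is the induction step.
  refine ⟨fun i j => ∑ t ∈ Finset.range j, ω (i • g) (t • g) g, fun i j l => ?_⟩
  induction l with
  | zero => simp [cochainD, H.apply_zero_right hn]
  | succ l ih =>
    have := H.pentagon (i • g) (j • g) (l • g) g
    simp only [cochainD, ← add_assoc, Finset.sum_range_succ, add_smul, one_smul] at ih this ⊢
    linear_combination (norm := abel) ih - this

/-- On sums of multiples of two elements the associativity function is a coboundary. -/
theorem exists_cochain_nsmul_add_nsmul (H : IsAbelianCocycle ω c) (hn : ∀ x y, ω x 0 y = 0)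
    (g₁ g₂ : G) : ∃ h : ℕ × ℕ → ℕ × ℕ → A, ∀ x y z : ℕ × ℕ,
      ω (x.1 • g₁ + x.2 • g₂) (y.1 • g₁ + y.2 • g₂) (z.1 • g₁ + z.2 • g₂) = cochainD h x y z := by
  obtain ⟨h₁, hh₁⟩ := H.exists_cochain_nsmul hn g₁
  obtain ⟨h₂, hh₂⟩ := H.exists_cochain_nsmul hn g₂
  -- The sign of the interchange is the one dictated by `interchange_assoc`.
  refine ⟨fun x y => h₁ x.1 y.1 + h₂ x.2 y.2 -
    interchange ω c (x.1 • g₁) (x.2 • g₂) (y.1 • g₁) (y.2 • g₂), fun x y z => ?_⟩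
  have := H.interchange_assoc (x.1 • g₁) (x.2 • g₂) (y.1 • g₁) (y.2 • g₂) (z.1 • g₁) (z.2 • g₂)
  rw [hh₁, hh₂] at this
  simp only [cochainD, Prod.fst_add, Prod.snd_add, add_smul] at this ⊢
  linear_combination (norm := abel) -this

end Monoid

/-! ### The braiding as a biadditive form -/

section Quadratic

variable [AddCommMonoid G] {ω : G → G → G → A} {c : G → G → A}

/-- After trivializing the associativity function, the braiding function is biadditive. -/
theorem braid_sub_biadditive (H : IsAbelianCocycle ω c) {h : G → G → A}
    (hh : ∀ x y z, ω x y z = cochainD h x y z) :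
    (∀ x y z, c (x + y) z - (h z (x + y) - h (x + y) z) =
      (c x z - (h z x - h x z)) + (c y z - (h z y - h y z))) ∧
    (∀ x y z, c x (y + z) - (h (y + z) x - h x (y + z)) =
      (c x y - (h y x - h x y)) + (c x z - (h z x - h x z))) := by
  constructor
  · intro x y z
    have := H.hexagon_left x y z
    simp only [hh, cochainD, add_comm z x, add_comm z y] at this
    linear_combination (norm := abel) this
  · intro x y z
    have := H.hexagon_right x y z
    simp only [hh, cochainD, add_comm x y, add_comm z x] at this
    linear_combination (norm := abel) this

end Quadratic

theorem biadditive_nat_prod {b : ℕ × ℕ → ℕ × ℕ → A} (hl : ∀ x y z, b (x + y) z = b x z + b y z)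
    (hr : ∀ x y z, b x (y + z) = b x y + b x z) (x y : ℕ × ℕ) :
    b x y = (x.1 * y.1) • b (1, 0) (1, 0) + (x.1 * y.2) • b (1, 0) (0, 1) +
      (x.2 * y.1) • b (0, 1) (1, 0) + (x.2 * y.2) • b (0, 1) (0, 1) := by
  let B : ℕ × ℕ →+ ℕ × ℕ →+ A := AddMonoidHom.mk' (fun x => AddMonoidHom.mk' (b x) (hr x))
    fun x y => AddMonoidHom.ext (hl x y)
  have key : ∀ x y, b x y = B x y := fun _ _ => rfl
  have hx : ∀ x : ℕ × ℕ, x = x.1 • (1, 0) + x.2 • (0, 1) := fun x => by ext <;> simp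
  rw [key, hx x, hx y]
  simp only [map_add, map_nsmul, AddMonoidHom.add_apply, AddMonoidHom.nsmul_apply, ← key,
    Prod.fst_add, Prod.snd_add, Prod.smul_fst, Prod.smul_snd, smul_eq_mul, mul_one, mul_zero,
    add_zero, zero_add]
  module

section Generators

variable [AddCommMonoid G] {ω : G → G → G → A} {c : G → G → A}

/-- The values of the braiding function on sums of multiples of two elements. -/
theorem exists_cochain_and_braid (H : IsAbelianCocycle ω c) (hn : ∀ x y, ω x 0 y = 0)
    (g₁ g₂ : G) : ∃ (h : ℕ × ℕ → ℕ × ℕ → A) (χ : A), (∀ x y z : ℕ × ℕ,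
      ω (x.1 • g₁ + x.2 • g₂) (y.1 • g₁ + y.2 • g₂) (z.1 • g₁ + z.2 • g₂) = cochainD h x y z) ∧
    ∀ x y : ℕ × ℕ, c (x.1 • g₁ + x.2 • g₂) (y.1 • g₁ + y.2 • g₂) - (h y x - h x y) =
      (x.1 * y.1) • c g₁ g₁ + (x.1 * y.2) • χ + (x.2 * y.1) • (c g₁ g₂ + c g₂ g₁ - χ) +
        (x.2 * y.2) • c g₂ g₂ := by
  obtain ⟨h, hh⟩ := H.exists_cochain_nsmul_add_nsmul hn g₁ g₂
  let f : ℕ × ℕ →+ G :=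
    { toFun := fun x => x.1 • g₁ + x.2 • g₂
      map_zero' := by simp
      map_add' := fun x y => by simp only [Prod.fst_add, Prod.snd_add]; module }
  obtain ⟨hl, hr⟩ := (H.comap f).braid_sub_biadditive hh
  -- χ is the mixed value of the biadditive form and depends on h. The correction h y x - h x y is
  -- antisymmetric, so the diagonal values and the sum of the two mixed values do not depend on h;
  -- this accounts for the coefficient c g₁ g₂ + c g₂ g₁ - χ.
  refine ⟨h, c g₁ g₂ - (h (0, 1) (1, 0) - h (1, 0) (0, 1)), hh, fun x y =>
    (biadditive_nat_prod (b := fun x y => c (f x) (f y) - (h y x - h x y)) hl hr x y).trans ?_⟩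
  have h1 : f (1, 0) = g₁ := by simp [f]
  have h2 : f (0, 1) = g₂ := by simp [f]
  simp only [h1, h2, sub_self, sub_zero]
  congr 3
  abel

/-- The antisymmetric correction vanishes on the diagonal, so c(x,x) inherits quadratic growth from
the biadditive form. For i•g = 0 this bounds the order of c g g. -/
theorem braid_nsmul_self (H : IsAbelianCocycle ω c) (hn : ∀ x y, ω x 0 y = 0) (g : G) (i : ℕ) :
    c (i • g) (i • g) = (i * i) • c g g := by
  obtain ⟨h, χ, -, hc⟩ := H.exists_cochain_and_braid hn g g
  simpa using hc (i, 0) (i, 0)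

/-- The antisymmetric correction cancels in the sum, leaving the polarization of the quadratic
function. When one argument is killed by its multiple, this bounds the order of c g₁ g₂ + c g₂ g₁.
-/
theorem braid_nsmul_add_swap (H : IsAbelianCocycle ω c) (hn : ∀ x y, ω x 0 y = 0) (g₁ g₂ : G)
    (i j : ℕ) :
    c (i • g₁) (j • g₂) + c (j • g₂) (i • g₁) = (i * j) • (c g₁ g₂ + c g₂ g₁) := by
  obtain ⟨h, χ, -, hc⟩ := H.exists_cochain_and_braid hn g₁ g₂
  have h1 := hc (i, 0) (0, j)
  have h2 := hc (0, j) (i, 0)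
  simp only [zero_smul, add_zero, zero_add, mul_zero, zero_mul, mul_comm j i, smul_sub] at h1 h2
  linear_combination (norm := abel) h1 + h2

/-- If the associated quadratic function vanishes, then the abelian cocycle becomes trivial on
`ℕ × ℕ`. -/
theorem exists_trivialization_nat_prod (H : IsAbelianCocycle ω c) (hn : ∀ x y, ω x 0 y = 0)
    {g₁ g₂ : G} (h₁ : c g₁ g₁ = 0) (h₂ : c g₂ g₂ = 0) (h₁₂ : c g₁ g₂ + c g₂ g₁ = 0) :
    ∃ h : ℕ × ℕ → ℕ × ℕ → A, IsTrivialization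
      (fun x y z : ℕ × ℕ =>
        ω (x.1 • g₁ + x.2 • g₂) (y.1 • g₁ + y.2 • g₂) (z.1 • g₁ + z.2 • g₂))
      (fun x y : ℕ × ℕ => c (x.1 • g₁ + x.2 • g₂) (y.1 • g₁ + y.2 • g₂)) h := by
  obtain ⟨h, χ, hh, hc⟩ := H.exists_cochain_and_braid hn g₁ g₂
  -- The remaining form is χ(x₁y₂ - x₂y₁). The added term is biadditive, so its coboundary is zero,
  -- while its antisymmetrization is exactly this form.
  refine ⟨fun x y => h x y - (x.1 * y.2) • χ, fun x y z => ?_, fun x y => ?_⟩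
  · have := hh x y z
    simp only [cochainD, Prod.fst_add, Prod.snd_add, add_mul, mul_add, add_smul] at this ⊢
    linear_combination (norm := abel) this
  · have := hc x y
    simp only [h₁, h₂, h₁₂, smul_zero, zero_sub, smul_neg, mul_comm x.2] at this ⊢
    linear_combination (norm := abel) this

end Generators

/-! ### Symmetric 2-cocycles and descent along a quotient map -/

section Descent

/-- A 2-cocycle on `ℕ` is a coboundary. -/
theorem exists_primitive_nat {η : ℕ → ℕ → A} (hη : ∀ x y z, cochainD η x y z = 0) :
    ∃ l : ℕ → A, ∀ x y, l (x + y) = l x + l y + η x y := by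
  -- The constant is forced by the equation at (0,0), because η is not assumed normalized.
  refine ⟨fun i => -η 0 0 + ∑ t ∈ Finset.range i, η t 1, fun x y => ?_⟩
  induction y with
  | zero =>
    have := hη x 0 0
    simp only [cochainD, add_zero, Finset.range_zero, Finset.sum_empty] at this ⊢
    linear_combination (norm := abel) this
  | succ y ih =>
    have := hη x y 1
    simp only [cochainD, ← add_assoc, Finset.sum_range_succ] at this ih ⊢
    linear_combination (norm := abel) ih - this

/-- A symmetric 2-cocycle on `ℕ × ℕ` is a coboundary. -/
theorem exists_primitive_nat_prod {η : ℕ × ℕ → ℕ × ℕ → A} (hη : ∀ x y z, cochainD η x y z = 0)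
    (hs : ∀ x y, η x y = η y x) :
    ∃ l : ℕ × ℕ → A, ∀ x y, l (x + y) = l x + l y + η x y := by
  obtain ⟨l₁, h₁⟩ := exists_primitive_nat (η := fun i j => η (i, 0) (j, 0))
    fun x y z => by simpa [cochainD] using hη (x, 0) (y, 0) (z, 0)
  obtain ⟨l₂, h₂⟩ := exists_primitive_nat (η := fun i j => η (0, i) (0, j))
    fun x y z => by simpa [cochainD] using hη (0, x) (0, y) (0, z)
  -- Each x is split as (x₁,0) + (0,x₂) in this order. Adding two such splittings requires
  -- exchanging (0,j) with (s,0), and this is the only use of symmetry.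
  refine ⟨fun x => l₁ x.1 + l₂ x.2 + η (x.1, 0) (0, x.2), ?_⟩
  rintro ⟨i, j⟩ ⟨s, t⟩
  have e1 := hη (i, 0) (0, j) (s, t)
  have e2 := hη (0, j) (s, 0) (0, t)
  have e3 := hη (s, 0) (0, j) (0, t)
  have e4 := hη (i, 0) (s, 0) (0, j + t)
  have e5 := hs (0, j) (s, 0)
  simp only [cochainD, Prod.mk_add_mk, add_zero, zero_add, h₁, h₂] at e1 e2 e3 e4 e5 ⊢
  linear_combination (norm := abel) e1 - e2 + e3 - e4 - e5

/-- A trivialization on a monoid `Γ` descends along `f : Γ → G` if each fibre of `f` is a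
free orbit of a monoid `P` on which symmetric 2-cocycles are coboundaries. -/
theorem exists_trivialization_of_fibration [AddCommMonoid G] {ω : G → G → G → A} {c : G → G → A}
    (H : IsAbelianCocycle ω c) (hn : ∀ x y, ω x 0 y = 0)
    {Γ P : Type*} [AddCommMonoid Γ] [AddCommMonoid P]
    (hP : ∀ η : P → P → A, (∀ x y z, cochainD η x y z = 0) → (∀ x y, η x y = η y x) →
      ∃ l : P → A, ∀ x y, l (x + y) = l x + l y + η x y)
    (f : Γ →+ G) (ι : P →+ Γ) (s : G → Γ) (q : Γ → P) (hs0 : s 0 = 0) (hfs : ∀ x, f (s x) = x)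
    (hfι : ∀ p, f (ι p) = 0) (hsq : ∀ a, s (f a) + ι (q a) = a) (hq : ∀ x p, q (s x + ι p) = p)
    {h : Γ → Γ → A} (hh : IsTrivialization (fun x y z => ω (f x) (f y) (f z))
      (fun x y => c (f x) (f y)) h) :
    ∃ h' : G → G → A, IsTrivialization ω c h' := by
  -- Since c(0,·) = 0, the braid condition says that h is symmetric against the kernel.
  have hcomm : ∀ a p, h a (ι p) = h (ι p) a := fun a p => by
    have := hh.braid (ι p) a
    rw [hfι, H.braid_zero_left hn] at this
    exact (sub_eq_zero.1 this.symm)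
  obtain ⟨l, hl⟩ := hP (fun x y => h (ι x) (ι y))
    (fun x y z => by
      have := hh.assoc (ι x) (ι y) (ι z)
      simp only [hfι, hn] at this
      simp only [cochainD, map_add] at this ⊢
      exact this.symm)
    fun x y => hcomm _ _
  -- θ is chosen so that the corrected cochain k below is constant both on pairs (section, kernel)
  -- and on pairs of kernel elements. The correction changes neither the coboundary nor the
  -- antisymmetrization.
  set θ : Γ → A := fun a => h (s (f a)) (ι (q a)) + l (q a) with hθ
  set k : Γ → Γ → A := fun a b => h a b + θ a + θ b - θ (a + b) with hk
  have kassoc : ∀ x y z, ω (f x) (f y) (f z) = cochainD k x y z := fun x y z => by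
    have := hh.assoc x y z
    simp only [hk, cochainD, add_assoc x y z] at this ⊢
    linear_combination (norm := abel) this
  have kbraid : ∀ x y, c (f x) (f y) = k y x - k x y := fun x y => by
    have := hh.braid x y
    simp only [hk, add_comm y x] at this ⊢
    linear_combination (norm := abel) this
  have hz : ∀ a, h a 0 = h 0 0 := fun a => by
    have := hh.assoc a 0 0
    simp only [map_zero, hn, cochainD, add_zero] at this
    linear_combination (norm := abel) this
  have hl0 : l 0 = -h 0 0 := by
    have := hl 0 0
    simp only [add_zero, map_zero] at this
    linear_combination (norm := abel) -this
  have θs : ∀ x p, θ (s x + ι p) = h (s x) (ι p) + l p := fun x p => by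
    simp only [hθ, map_add, hfs, hfι, add_zero, hq]
  have θs0 : ∀ x, θ (s x) = 0 := fun x => by
    have := θs x 0
    rw [map_zero, add_zero, hz, hl0, add_neg_cancel] at this
    exact this
  have θι : ∀ p, θ (ι p) = h 0 0 + l p := fun p => by
    have := θs 0 p
    have h0 := hcomm 0 p
    rw [hz] at h0
    rwa [hs0, zero_add, h0] at this
  have ks : ∀ x p, k (s x) (ι p) = h 0 0 := fun x p => by
    simp only [hk, θs, θs0, θι]; abel
  have kι : ∀ p p', k (ι p) (ι p') = h 0 0 := fun p p' => by
    simp only [hk, ← map_add, θι, hl]; abel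
  -- Associativity at (s (f a), ι (q a), ι p), where ω vanishes, extends the constancy from the
  -- section and the kernel to all of Γ.
  have kr : ∀ a p, k a (ι p) = h 0 0 := fun a p => by
    have := kassoc (s (f a)) (ι (q a)) (ι p)
    simp only [hfι, hn, cochainD, ks, kι, hsq, ← map_add] at this
    linear_combination (norm := abel) this
  have kl : ∀ a p, k (ι p) a = h 0 0 := fun a p => by
    have := kbraid a (ι p)
    rw [hfι, H.braid_zero_right hn, kr] at this
    exact sub_eq_zero.1 this.symm
  -- With k constant against the kernel and ω zero when an outer argument is zero, the coboundary
  -- equation becomes invariance of k under translation by the kernel. Hence k factors through f.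
  have kr' : ∀ a b p, k a (b + ι p) = k a b := fun a b p => by
    have := kassoc a b (ι p)
    simp only [hfι, H.apply_zero_right hn, cochainD, kr] at this
    linear_combination (norm := abel) -this
  have kl' : ∀ a b p, k (a + ι p) b = k a b := fun a b p => by
    have := kassoc (ι p) a b
    simp only [hfι, H.apply_zero_left hn, cochainD, kl, add_comm (ι p) a] at this
    linear_combination (norm := abel) this
  have kf : ∀ a b, k a b = k (s (f a)) (s (f b)) := fun a b => by
    conv_lhs => rw [← hsq a, ← hsq b, kr', kl']
  refine ⟨fun x y => k (s x) (s y), fun x y z => ?_, fun x y => ?_⟩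
  · have := kassoc (s x) (s y) (s z)
    simp only [cochainD] at this ⊢
    rw [kf (s x) (s y + s z), kf (s x + s y) (s z)] at this
    simpa only [map_add, hfs] using this
  · simpa only [hfs] using kbraid (s x) (s y)

end Descent

end IsAbelianCocycle

/-! ### Vanishing quadratic data on two cyclic factors -/

namespace IsAbelianCocycle

section TwoCyclicGroups

variable {A : Type*} [AddCommGroup A] {m n : ℕ} [NeZero m] [NeZero n]

/-- Division with remainder presents ℕ × ℕ → ℤ/m × ℤ/n as a fibration: the least residues are the
section, the quotients are the fibre coordinate, and the kernel mℕ × nℕ is a copy of ℕ × ℕ, where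
symmetric 2-cocycles have primitives. -/
theorem exists_trivialization_zmod_prod {ω : ZMod m × ZMod n → ZMod m × ZMod n →
      ZMod m × ZMod n → A} {c : ZMod m × ZMod n → ZMod m × ZMod n → A}
    (H : IsAbelianCocycle ω c) (hn : ∀ x y, ω x 0 y = 0)
    (h₁ : c (1, 0) (1, 0) = 0) (h₂ : c (0, 1) (0, 1) = 0)
    (h₁₂ : c (1, 0) (0, 1) + c (0, 1) (1, 0) = 0) :
    ∃ h : ZMod m × ZMod n → ZMod m × ZMod n → A, IsTrivialization ω c h := by
  obtain ⟨h, hh⟩ := H.exists_trivialization_nat_prod hn h₁ h₂ h₁₂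
  have hf : ∀ x : ℕ × ℕ, (x.1 • (1, 0) + x.2 • (0, 1) : ZMod m × ZMod n) = (↑x.1, ↑x.2) :=
    fun x => by ext <;> simp
  simp only [hf] at hh
  have hm : 0 < m := Nat.pos_of_neZero m
  have hn' : 0 < n := Nat.pos_of_neZero n
  refine H.exists_trivialization_of_fibration hn
    (fun η h1 h2 => exists_primitive_nat_prod h1 h2)
    ((Nat.castAddMonoidHom (ZMod m)).prodMap (Nat.castAddMonoidHom (ZMod n)))
    ((nsmulAddMonoidHom m).prodMap (nsmulAddMonoidHom n)) (fun x => (x.1.val, x.2.val))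
    (fun x => (x.1 / m, x.2 / n)) ?_ ?_ ?_ ?_ ?_ hh
  · simp
  · simp
  · simp
  · simp [ZMod.val_natCast, Nat.mod_add_div]
  · rintro ⟨x, y⟩ ⟨p, q⟩
    simp [Nat.add_mul_div_left _ _ hm, Nat.add_mul_div_left _ _ hn',
      Nat.div_eq_of_lt (ZMod.val_lt x), Nat.div_eq_of_lt (ZMod.val_lt y)]

end TwoCyclicGroups

end IsAbelianCocycle

/-! ### Every class contains a standard pair with b = 0 -/

section Classification

variable {k : Type u} [Field k]

/-- A quasi-bicharacter, written additively, is an abelian cocycle. -/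
theorem QuasiBicharacter.isAbelianCocycle {G : Type w} [AddCommGroup G] {Φ : ThreeCocycle k G}
    (R : QuasiBicharacter Φ) :
    IsAbelianCocycle (A := Additive kˣ) (fun x y z => .ofMul (Φ.toFun x y z))
      (fun x y => .ofMul (R.toFun x y)) where
  pentagon x y z t := congrArg Additive.ofMul (Φ.cocycle x y z t)
  hexagon_left x y z := by
    have := congrArg Additive.ofMul (R.add_left x y z)
    simp only [ofMul_mul, ofMul_inv] at this
    rw [this]; abel
  hexagon_right x y z := by
    have := congrArg Additive.ofMul (R.add_right x y z)
    simp only [ofMul_mul, ofMul_inv] at this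
    rw [this]; abel

theorem exists_lt_pow_eq {m : ℕ} [NeZero m] {ζ : kˣ} (hζ : IsPrimitiveRoot ζ m) {r : kˣ}
    (h1 : r ^ (m * m) = 1) : ∃ a < m, r ^ m = ζ ^ a := by
  have h2 : ((r ^ m : kˣ) : k) ^ m = 1 := by
    rw [← Units.val_pow_eq_pow_val, ← pow_mul, h1, Units.val_one]
  obtain ⟨a, ha, h⟩ := (IsPrimitiveRoot.coe_units_iff.2 hζ).eq_pow_of_pow_eq_one h2
  exact ⟨a, ha, Units.ext (by simpa using h.symm)⟩

/-- In `ZMod 1` the representative of 1 is 0, so the exponent collapses; the hypotheses cover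
exactly these degenerate factors. -/
theorem pow_val_one_mul_val_one {m n : ℕ} {r : kˣ} (hm : m = 1 → r = 1) (hn : n = 1 → r = 1) :
    r ^ ((1 : ZMod m).val * (1 : ZMod n).val) = r := by
  by_cases h1 : m = 1
  · rw [hm h1, one_pow]
  by_cases h2 : n = 1
  · rw [hn h2, one_pow]
  rw [ZMod.val_one'' h1, ZMod.val_one'' h2, mul_one, pow_one]

/-- Every abelian 3-cocycle on `ℤ/m × ℤ/n` with values in `kˣ` is cohomologous to some
`(Φ_{a,0,d}, R_r)`. -/
theorem exists_cohomologous_quasiBicharacterABD {m n : ℕ} [NeZero m] [NeZero n] {ζm ζn : kˣ}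
    (hm : IsPrimitiveRoot ζm m) (hn : IsPrimitiveRoot ζn n)
    {ω : ZMod m × ZMod n → ZMod m × ZMod n → ZMod m × ZMod n → kˣ}
    {c : ZMod m × ZMod n → ZMod m × ZMod n → kˣ}
    (H : IsAbelianCocycle (A := Additive kˣ) (fun x y z => .ofMul (ω x y z))
      (fun x y => .ofMul (c x y))) :
    ∃ a < m, ∃ d < n, ∃ (r : ParamABD m n ζm ζn a 0 d)
      (h : ZMod m × ZMod n → ZMod m × ZMod n → kˣ),
      (∀ x y z, h x y * h (x + y) z * ω x y z =
        (cocycleABD ζm ζn hm.pow_eq_one hn.pow_eq_one a 0 d).toFun x y z *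
          (h y z * h x (y + z))) ∧
      ∀ x y, h x y * c x y =
        (quasiBicharacterABD ζm ζn hm.pow_eq_one hn.pow_eq_one a 0 d r).toFun x y * h y x := by
  obtain ⟨h₀, H', hnorm⟩ := H.exists_normalized
  have hc0 := H'.braid_zero_left hnorm
  have hme : (m • (1, 0) : ZMod m × ZMod n) = 0 := by ext <;> simp
  have hne : (n • (0, 1) : ZMod m × ZMod n) = 0 := by ext <;> simp
  obtain ⟨r11, e11⟩ : ∃ r, r = c (1, 0) (1, 0) := ⟨_, rfl⟩
  obtain ⟨r22, e22⟩ : ∃ r, r = c (0, 1) (0, 1) := ⟨_, rfl⟩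
  obtain ⟨r21, e21⟩ : ∃ r, r = c (1, 0) (0, 1) * c (0, 1) (1, 0) := ⟨_, rfl⟩
  -- The multiple m•(1,0) is zero, so quadraticity makes the m²-th power trivial. The polarization
  -- below gives the 2m-th power, which is the condition ζ_m^a = ζ_m^(-a).
  have h11 : r11 ^ (m * m) = 1 := by
    have := H'.braid_nsmul_self hnorm (1, 0) m
    rw [hme, hc0, sub_self, sub_zero, ← e11, ← ofMul_pow] at this
    exact (Additive.ofMul.injective this).symm
  have h22 : r22 ^ (n * n) = 1 := by
    have := H'.braid_nsmul_self hnorm (0, 1) n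
    rw [hne, hc0, sub_self, sub_zero, ← e22, ← ofMul_pow] at this
    exact (Additive.ofMul.injective this).symm
  have h11' : r11 ^ m * r11 ^ m = 1 := by
    have := H'.braid_nsmul_add_swap hnorm (1, 0) (1, 0) m 1
    rw [hme, hc0, H'.braid_zero_right hnorm, sub_self, sub_zero, ← e11, ← ofMul_mul, ← ofMul_pow,
      mul_one, add_zero, mul_pow] at this
    exact (Additive.ofMul.injective this).symm
  have h22' : r22 ^ n * r22 ^ n = 1 := by
    have := H'.braid_nsmul_add_swap hnorm (0, 1) (0, 1) n 1
    rw [hne, hc0, H'.braid_zero_right hnorm, sub_self, sub_zero, ← e22, ← ofMul_mul, ← ofMul_pow,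
      mul_one, add_zero, mul_pow] at this
    exact (Additive.ofMul.injective this).symm
  have hsum : Additive.ofMul (c (1, 0) (0, 1)) - (h₀ (0, 1) (1, 0) - h₀ (1, 0) (0, 1)) +
      (Additive.ofMul (c (0, 1) (1, 0)) - (h₀ (1, 0) (0, 1) - h₀ (0, 1) (1, 0))) =
      Additive.ofMul r21 := by
    rw [e21, ofMul_mul]; abel
  have h21m : r21 ^ m = 1 := by
    have := H'.braid_nsmul_add_swap hnorm (1, 0) (0, 1) m 1
    rw [hme, hc0, H'.braid_zero_right hnorm, hsum, ← ofMul_pow, mul_one, add_zero] at this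
    exact (Additive.ofMul.injective this).symm
  have h21n : r21 ^ n = 1 := by
    have := H'.braid_nsmul_add_swap hnorm (1, 0) (0, 1) 1 n
    rw [hne, hc0, H'.braid_zero_right hnorm, hsum, ← ofMul_pow, one_mul, add_zero] at this
    exact (Additive.ofMul.injective this).symm
  obtain ⟨a, ha, hra⟩ := exists_lt_pow_eq hm h11
  obtain ⟨d, hd, hrd⟩ := exists_lt_pow_eq hn h22
  -- Only the product r₁₂r₂₁ is visible in the quadratic function. Putting all of it into r₂₁ leaves
  -- r₁₂ = 1, and since its m-th and n-th powers are both 1, the conditions hold with b = 0.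
  let r : ParamABD m n ζm ζn a 0 d :=
    { r11 := r11, r12 := 1, r21 := r21, r22 := r22
      r11_pow := hra
      r11_pow' := by rw [← hra]; exact eq_inv_of_mul_eq_one_left h11'
      r22_pow := hrd
      r22_pow' := by rw [← hrd]; exact eq_inv_of_mul_eq_one_left h22'
      r12_pow_n := one_pow n
      r12_pow_m := by simp
      r21_pow_n := h21n
      r21_pow_m := by simpa using h21m }
  obtain ⟨R, hR⟩ : ∃ R, R = quasiBicharacterABD ζm ζn hm.pow_eq_one hn.pow_eq_one a 0 d r :=
    ⟨_, rfl⟩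
  have R11 : R.toFun (1, 0) (1, 0) = r11 := by
    simp only [hR, quasiBicharacterABD, r, ZMod.val_zero, mul_zero, zero_mul, pow_zero,
      mul_one, one_pow]
    exact pow_val_one_mul_val_one (by rintro rfl; simpa using h11) (by rintro rfl; simpa using h11)
  have R22 : R.toFun (0, 1) (0, 1) = r22 := by
    simp only [hR, quasiBicharacterABD, r, ZMod.val_zero, mul_zero, pow_zero, one_mul, mul_one,
      one_pow]
    exact pow_val_one_mul_val_one (by rintro rfl; simpa using h22) (by rintro rfl; simpa using h22)
  have R12 : R.toFun (1, 0) (0, 1) = 1 := by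
    simp [hR, quasiBicharacterABD, r]
  have R21 : R.toFun (0, 1) (1, 0) = r21 := by
    simp only [hR, quasiBicharacterABD, r, ZMod.val_zero, mul_zero, zero_mul, pow_zero, one_mul,
      mul_one, one_pow]
    exact pow_val_one_mul_val_one (by rintro rfl; simpa using h21n)
      (by rintro rfl; simpa using h21m)
  -- The standard pair has the same three invariants, so the difference has none and is a
  -- coboundary. The total cochain is the normalizing one plus this trivialization.
  obtain ⟨h₁, T⟩ := (H'.sub R.isAbelianCocycle).exists_trivialization_zmod_prod
    (fun x y => by
      rw [ThreeCocycle.normalized _ x 0 y (Or.inr (Or.inl rfl)), ofMul_one, sub_zero]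
      exact hnorm x y)
    (by rw [R11, sub_self, sub_zero, e11, sub_self])
    (by rw [R22, sub_self, sub_zero, e22, sub_self])
    (by
      rw [R12, R21, ofMul_one, sub_zero, add_sub, hsum, sub_self])
  refine ⟨a, ha, d, hd, r, fun x y => (h₀ x y + h₁ x y).toMul, fun x y z => ?_, fun x y => ?_⟩
  · have := T.assoc x y z
    apply Additive.ofMul.injective
    simp only [ofMul_mul, ofMul_toMul, cochainD] at this ⊢
    linear_combination (norm := abel) this
  · rw [← hR]
    have := T.braid x y
    apply Additive.ofMul.injective
    simp only [ofMul_mul, ofMul_toMul] at this ⊢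
    linear_combination (norm := abel) this

end Classification

/-! ### One-dimensional objects and natural isomorphisms as scalars -/

namespace GrVec

section Simple

variable {k : Type u} [Field k] {G : Type w} [DecidableEq G] [Fintype G] [AddCommGroup G]

/-- The one-dimensional object concentrated in degree `x`. -/
abbrev simple (k : Type u) [Field k] {G : Type w} [DecidableEq G] [Fintype G] (x : G) :
    GrVec k G where
  carrier := k
  comp g := if g = x then ⊤ else ⊥
  isInternal := by
    refine isInternal_of_proj _ (fun g => if g = x then LinearMap.id else 0) ?_ ?_ ?_
    · intro g v
      by_cases h : g = x <;> simp [h]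
    · intro v
      rw [Finset.sum_eq_single x] <;> simp +contextual
    · intro g v hv g'
      by_cases h : g = x
      · subst h
        by_cases h' : g' = g <;> simp [h', Ne.symm]
      · simp only [h, if_false, Submodule.mem_bot] at hv
        subst hv; simp

theorem one_mem_simple (x : G) : (1 : k) ∈ (simple k x).comp x := by
  simp [simple]

/-- A homogeneous element of degree `x` as a morphism out of the simple object of degree `x`. -/
def ofElem (V : GrVec k G) {x : G} {v : V.carrier} (hv : v ∈ V.comp x) : simple k x ⟶ V :=
  ofLin (LinearMap.toSpanSingleton k V.carrier v) fun g a ha => by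
    by_cases h : g = x
    · subst h; simpa using Submodule.smul_mem _ a hv
    · have : a ∈ (if g = x then ⊤ else ⊥ : Submodule k k) := ha
      simp only [h, if_false, Submodule.mem_bot] at this
      subst this; simp

@[simp] theorem lin_ofElem_one (V : GrVec k G) {x : G} {v : V.carrier} (hv : v ∈ V.comp x) :
    lin (ofElem V hv) (1 : k) = v := by
  simp [ofElem]

theorem eq_smul_one_tmul_one (t : k ⊗[k] k) : ∃ a : k, t = a • (1 ⊗ₜ 1) :=
  ⟨TensorProduct.lid k k t, by
    apply (TensorProduct.lid k k).injective; simp⟩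

theorem eq_smul_one_tmul_one_tmul_one (t : k ⊗[k] (k ⊗[k] k)) :
    ∃ a : k, t = a • (1 ⊗ₜ (1 ⊗ₜ 1)) := by
  obtain ⟨a, ha⟩ := eq_smul_one_tmul_one (TensorProduct.lid k _ t)
  exact ⟨a, (TensorProduct.lid k _).injective (by simpa using ha)⟩

theorem lin_hom_inv {V W : GrVec k G} (f : V ≅ W) (v : V.carrier) :
    lin f.inv (lin f.hom v) = v :=
  LinearMap.congr_fun (congrArg lin f.hom_inv_id) v

/-- A natural isomorphism `(V ⊗ W) ⊗ U ≅ V ⊗ (W ⊗ U)` acts by scalars on homogeneous elements. -/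
theorem exists_scalar_of_natural₃
    (a : ∀ V W U : GrVec k G, tensor (tensor V W) U ≅ tensor V (tensor W U))
    (ha : ∀ {V V' W W' U U' : GrVec k G} (f : V ⟶ V') (g : W ⟶ W') (h : U ⟶ U'),
      tensorMap (tensorMap f g) h ≫ (a V' W' U').hom =
        (a V W U).hom ≫ tensorMap f (tensorMap g h)) :
    ∃ ω : G → G → G → kˣ, ∀ {V W U : GrVec k G} {x y z : G} {v : V.carrier} {w : W.carrier}
      {u : U.carrier}, v ∈ V.comp x → w ∈ W.comp y → u ∈ U.comp z →
      lin (a V W U).hom ((v ⊗ₜ w) ⊗ₜ u) = (ω x y z : k) • (v ⊗ₜ (w ⊗ₜ u)) := by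
  have h0 : ∀ x y z, ∃ s : kˣ, lin (a (simple k x) (simple k y) (simple k z)).hom
      (((1 : k) ⊗ₜ (1 : k)) ⊗ₜ (1 : k)) = (s : k) • ((1 : k) ⊗ₜ ((1 : k) ⊗ₜ (1 : k))) := by
    intro x y z
    obtain ⟨s, hs⟩ := eq_smul_one_tmul_one_tmul_one
      (lin (a (simple k x) (simple k y) (simple k z)).hom (((1 : k) ⊗ₜ (1 : k)) ⊗ₜ (1 : k)))
    refine ⟨Units.mk0 s ?_, hs⟩
    rintro rfl
    have h1 := lin_hom_inv (a (simple k x) (simple k y) (simple k z))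
      (((1 : k) ⊗ₜ (1 : k)) ⊗ₜ (1 : k))
    rw [hs, zero_smul, LinearMap.map_zero] at h1
    have h2 := congrArg (fun t => TensorProduct.lid k k (TensorProduct.map
      (TensorProduct.lid k k).toLinearMap LinearMap.id t)) h1
    simp at h2
  choose ω hω using h0
  refine ⟨ω, fun {V W U x y z v w u} hv hw hu => ?_⟩
  -- Homogeneous vectors are images of 1 under maps out of one-dimensional objects, so naturality
  -- carries the scalar over to arbitrary V, W, U.
  have := LinearMap.congr_fun (congrArg lin (ha (ofElem V hv) (ofElem W hw) (ofElem U hu)))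
    (((1 : k) ⊗ₜ (1 : k)) ⊗ₜ (1 : k))
  simp only [lin_comp, LinearMap.comp_apply, lin_tensorMap] at this
  rw [hω, map_smul] at this
  have ev := lin_ofElem_one V hv
  have ew := lin_ofElem_one W hw
  have eu := lin_ofElem_one U hu
  calc _ = lin (a V W U).hom ((lin (ofElem V hv) (1 : k) ⊗ₜ lin (ofElem W hw) (1 : k)) ⊗ₜ
        lin (ofElem U hu) (1 : k)) := by rw [ev, ew, eu]
    _ = (ω x y z : k) • (lin (ofElem V hv) (1 : k) ⊗ₜ (lin (ofElem W hw) (1 : k) ⊗ₜ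
        lin (ofElem U hu) (1 : k))) := this
    _ = _ := by rw [ev, ew, eu]

/-- A natural isomorphism `V ⊗ W ≅ W ⊗ V` acts by scalars on homogeneous elements. -/
theorem exists_scalar_of_natural₂
    (b : ∀ V W : GrVec k G, tensor V W ≅ tensor W V)
    (hb : ∀ {V V' W W' : GrVec k G} (f : V ⟶ V') (g : W ⟶ W'),
      tensorMap f g ≫ (b V' W').hom = (b V W).hom ≫ tensorMap g f) :
    ∃ c : G → G → kˣ, ∀ {V W : GrVec k G} {x y : G} {v : V.carrier} {w : W.carrier},
      v ∈ V.comp x → w ∈ W.comp y →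
      lin (b V W).hom (v ⊗ₜ w) = (c x y : k) • (w ⊗ₜ v) := by
  have h0 : ∀ x y, ∃ s : kˣ, lin (b (simple k x) (simple k y)).hom
      ((1 : k) ⊗ₜ (1 : k)) = (s : k) • ((1 : k) ⊗ₜ (1 : k)) := by
    intro x y
    obtain ⟨s, hs⟩ := eq_smul_one_tmul_one
      (lin (b (simple k x) (simple k y)).hom ((1 : k) ⊗ₜ (1 : k)))
    refine ⟨Units.mk0 s ?_, hs⟩
    rintro rfl
    have h1 := lin_hom_inv (b (simple k x) (simple k y)) ((1 : k) ⊗ₜ (1 : k))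
    rw [hs, zero_smul, LinearMap.map_zero] at h1
    have h2 := congrArg (TensorProduct.lid k k) h1
    simp at h2
  choose c hc using h0
  refine ⟨c, fun {V W x y v w} hv hw => ?_⟩
  have := LinearMap.congr_fun (congrArg lin (hb (ofElem V hv) (ofElem W hw)))
    ((1 : k) ⊗ₜ (1 : k))
  simp only [lin_comp, LinearMap.comp_apply, lin_tensorMap] at this
  rw [hc, map_smul] at this
  have ev := lin_ofElem_one V hv
  have ew := lin_ofElem_one W hw
  calc _ = lin (b V W).hom (lin (ofElem V hv) (1 : k) ⊗ₜ lin (ofElem W hw) (1 : k)) := by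
        rw [ev, ew]
    _ = (c x y : k) • (lin (ofElem W hw) (1 : k) ⊗ₜ lin (ofElem V hv) (1 : k)) := this
    _ = _ := by rw [ev, ew]

end Simple

end GrVec

/-! ### Transport to the graded tensor product -/

/-- The category `Vec_G` with its graded tensor product, as the carrier of a braided monoidal
structure transported along an isomorphism `φ` between a given tensor product and the graded one. -/
def GrVecTransported {k : Type u} [Field k] {G : Type w} [DecidableEq G] [Fintype G]
    [AddCommGroup G] [MonoidalCategory (GrVec k G)]
    (_φ : curriedTensor (GrVec k G) ≅ GrVec.tensorFunctor k G) := GrVec k G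

namespace GrVecTransported

open GrVec

variable {k : Type u} [Field k] {G : Type w} [DecidableEq G] [Fintype G] [AddCommGroup G]
  [MonoidalCategory (GrVec k G)] (φ : curriedTensor (GrVec k G) ≅ GrVec.tensorFunctor k G)

/-- The components of `φ`. -/
def compIso (V W : GrVec k G) : V ⊗ W ≅ tensor V W := (φ.app V).app W

theorem compIso_natural_left {V V' : GrVec k G} (f : V ⟶ V') (W : GrVec k G) :
    f ▷ W ≫ (compIso φ V' W).hom = (compIso φ V W).hom ≫ tensorMap f (𝟙 W) :=
  congrArg (fun t => NatTrans.app t W) (φ.hom.naturality f)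

theorem compIso_natural_left_assoc {V V' : GrVec k G} (f : V ⟶ V') (W : GrVec k G) {Z : GrVec k G}
    (t : tensor V' W ⟶ Z) :
    f ▷ W ≫ (compIso φ V' W).hom ≫ t = (compIso φ V W).hom ≫ tensorMap f (𝟙 W) ≫ t := by
  rw [← Category.assoc, compIso_natural_left, Category.assoc]

theorem compIso_natural_right (V : GrVec k G) {W W' : GrVec k G} (f : W ⟶ W') :
    V ◁ f ≫ (compIso φ V W').hom = (compIso φ V W).hom ≫ tensorMap (𝟙 V) f :=
  (φ.hom.app V).naturality f

theorem compIso_inv_natural_left {V V' : GrVec k G} (f : V ⟶ V') (W : GrVec k G) :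
    tensorMap f (𝟙 W) ≫ (compIso φ V' W).inv = (compIso φ V W).inv ≫ f ▷ W := by
  rw [Iso.comp_inv_eq, Category.assoc, compIso_natural_left, Iso.inv_hom_id_assoc]

theorem compIso_inv_natural_left_assoc {V V' : GrVec k G} (f : V ⟶ V') (W : GrVec k G)
    {Z : GrVec k G} (t : V' ⊗ W ⟶ Z) :
    tensorMap f (𝟙 W) ≫ (compIso φ V' W).inv ≫ t = (compIso φ V W).inv ≫ f ▷ W ≫ t := by
  rw [← Category.assoc, compIso_inv_natural_left, Category.assoc]

theorem compIso_inv_natural_right (V : GrVec k G) {W W' : GrVec k G} (f : W ⟶ W') :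
    tensorMap (𝟙 V) f ≫ (compIso φ V W').inv = (compIso φ V W).inv ≫ V ◁ f := by
  rw [Iso.comp_inv_eq, Category.assoc, compIso_natural_right, Iso.inv_hom_id_assoc]

theorem tensorMap_def {V V' W W' : GrVec k G} (f : V ⟶ V') (g : W ⟶ W') :
    tensorMap f g = tensorMap f (𝟙 W) ≫ tensorMap (𝟙 V') g :=
  hom_ext (TensorProduct.ext' fun _ _ => rfl)

theorem compIso_inv_natural {V V' W W' : GrVec k G} (f : V ⟶ V') (g : W ⟶ W') :
    tensorMap f g ≫ (compIso φ V' W').inv = (compIso φ V W).inv ≫ (f ⊗ₘ g) := by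
  rw [tensorMap_def, Category.assoc, compIso_inv_natural_right, compIso_inv_natural_left_assoc,
    MonoidalCategory.tensorHom_def]

theorem compIso_inv_natural_assoc {V V' W W' : GrVec k G} (f : V ⟶ V') (g : W ⟶ W')
    {Z : GrVec k G} (t : V' ⊗ W' ⟶ Z) :
    tensorMap f g ≫ (compIso φ V' W').inv ≫ t = (compIso φ V W).inv ≫ (f ⊗ₘ g) ≫ t := by
  rw [← Category.assoc, compIso_inv_natural, Category.assoc]

theorem compIso_natural {V V' W W' : GrVec k G} (f : V ⟶ V') (g : W ⟶ W') :
    (f ⊗ₘ g) ≫ (compIso φ V' W').hom = (compIso φ V W).hom ≫ tensorMap f g := by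
  rw [tensorMap_def, MonoidalCategory.tensorHom_def, Category.assoc, compIso_natural_right,
    compIso_natural_left_assoc]

/-- The transported associativity constraint. -/
def assoc (V W U : GrVec k G) : tensor (tensor V W) U ≅ tensor V (tensor W U) :=
  ((compIso φ (tensor V W) U).symm ≪≫ ((compIso φ V W).symm ⊗ᵢ .refl U)) ≪≫ α_ V W U ≪≫
    ((.refl V ⊗ᵢ compIso φ W U) ≪≫ compIso φ V (tensor W U))

/-- The transported left unit constraint. -/
def leftUnit (V : GrVec k G) : tensor (𝟙_ (GrVec k G)) V ≅ V :=
  ((compIso φ (𝟙_ (GrVec k G)) V).symm ≪≫ ((Iso.refl _).symm ⊗ᵢ .refl V)) ≪≫ λ_ V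

/-- The transported right unit constraint. -/
def rightUnit (V : GrVec k G) : tensor V (𝟙_ (GrVec k G)) ≅ V :=
  ((compIso φ V (𝟙_ (GrVec k G))).symm ≪≫ (.refl V ⊗ᵢ (Iso.refl _).symm)) ≪≫ ρ_ V

theorem assoc_natural {V V' W W' U U' : GrVec k G} (f : V ⟶ V') (g : W ⟶ W') (h : U ⟶ U') :
    tensorMap (tensorMap f g) h ≫ (assoc φ V' W' U').hom =
      (assoc φ V W U).hom ≫ tensorMap f (tensorMap g h) := by
  have e1 : (tensorMap f g ⊗ₘ h) ≫ ((compIso φ V' W').inv ⊗ₘ 𝟙 U') =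
      ((compIso φ V W).inv ⊗ₘ 𝟙 U) ≫ ((f ⊗ₘ g) ⊗ₘ h) := by
    simp only [tensorHom_comp_tensorHom, compIso_inv_natural, Category.comp_id, Category.id_comp]
  have e2 : (f ⊗ₘ (g ⊗ₘ h)) ≫ (𝟙 V' ⊗ₘ (compIso φ W' U').hom) =
      (𝟙 V ⊗ₘ (compIso φ W U).hom) ≫ (f ⊗ₘ tensorMap g h) := by
    simp only [tensorHom_comp_tensorHom, compIso_natural, Category.comp_id, Category.id_comp]
  simp only [assoc, Iso.trans_hom, Iso.symm_hom, tensorIso_hom, Iso.refl_hom, Category.assoc]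
  rw [compIso_inv_natural_assoc, reassoc_of% e1, associator_naturality_assoc, reassoc_of% e2,
    compIso_natural]

theorem leftUnit_natural {V V' : GrVec k G} (f : V ⟶ V') :
    tensorMap (𝟙 _) f ≫ (leftUnit φ V').hom = (leftUnit φ V).hom ≫ f := by
  simp [leftUnit, compIso_inv_natural_assoc]

theorem rightUnit_natural {V V' : GrVec k G} (f : V ⟶ V') :
    tensorMap f (𝟙 _) ≫ (rightUnit φ V').hom = (rightUnit φ V).hom ≫ f := by
  simp [rightUnit, compIso_inv_natural_assoc]

instance : Category (GrVecTransported φ) := inferInstanceAs (Category (GrVec k G))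

instance : MonoidalCategoryStruct (GrVecTransported φ) where
  tensorObj V W := tensor (k := k) (G := G) V W
  whiskerLeft V _ _ f := tensorMap (k := k) (G := G) (𝟙 V) f
  whiskerRight f W := tensorMap (k := k) (G := G) f (𝟙 W)
  tensorHom f f' := tensorMap (k := k) (G := G) f f'
  tensorUnit := 𝟙_ (GrVec k G)
  associator V W U := assoc φ V W U
  leftUnitor V := leftUnit φ V
  rightUnitor V := rightUnit φ V

/-- The identity functor to `Vec_G` with the given monoidal structure. -/
def toGrVec : GrVecTransported φ ⥤ GrVec k G := 𝟭 (GrVec k G)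

instance : (toGrVec φ).Faithful := inferInstanceAs (𝟭 (GrVec k G)).Faithful

/-- The identity functor preserves the monoidal data up to `φ`. -/
def inducingData : Monoidal.InducingFunctorData (toGrVec φ) where
  μIso V W := compIso φ V W
  εIso := Iso.refl _
  whiskerLeft_eq V _ _ f := ((Iso.eq_inv_comp _).2 (compIso_natural_right φ V f).symm)
  whiskerRight_eq f W := ((Iso.eq_inv_comp _).2 (compIso_natural_left φ f W).symm)
  tensorHom_eq f g := ((Iso.eq_inv_comp _).2 (compIso_natural φ f g).symm)
  -- `assoc`, `leftUnit` and `rightUnit` keep their redundant identity isomorphisms so that they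
  -- match the required composites definitionally.
  associator_eq _ _ _ := rfl
  leftUnitor_eq _ := rfl
  rightUnitor_eq _ := rfl

instance : MonoidalCategory (GrVecTransported φ) := Monoidal.induced (toGrVec φ) (inducingData φ)

instance : (toGrVec φ).Monoidal := Monoidal.fromInducedMonoidal (toGrVec φ) (inducingData φ)

variable [BraidedCategory (GrVec k G)]

/-- The transported braiding. -/
def braid (V W : GrVec k G) : tensor V W ≅ tensor W V :=
  (compIso φ V W).symm ≪≫ β_ V W ≪≫ compIso φ W V

theorem braid_natural {V V' W W' : GrVec k G} (f : V ⟶ V') (g : W ⟶ W') :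
    tensorMap f g ≫ (braid φ V' W').hom = (braid φ V W).hom ≫ tensorMap g f := by
  simp only [braid, Iso.trans_hom, Iso.symm_hom, compIso_inv_natural_assoc, Category.assoc,
    ← compIso_natural, BraidedCategory.braiding_naturality_assoc]

theorem compIso_comp_braid (V W : GrVec k G) :
    (compIso φ V W).hom ≫ (braid φ V W).hom = (β_ V W).hom ≫ (compIso φ W V).hom := by
  simp [braid]

/-- The hexagons are reflected by the faithful identity functor from the given structure. -/
instance : BraidedCategory (GrVecTransported φ) :=
  .ofFaithful (toGrVec φ) (fun V W => braid φ V W) (compIso_comp_braid φ)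

end GrVecTransported

/-! ### Pentagon and hexagons as equations between scalars -/

namespace GrVecTransported

open GrVec

variable {k : Type u} [Field k] {G : Type w} [DecidableEq G] [Fintype G] [AddCommGroup G]
  [MonoidalCategory (GrVec k G)] (φ : curriedTensor (GrVec k G) ≅ GrVec.tensorFunctor k G)

/-- `ω` gives the scalars by which the transported associativity constraint acts. -/
def IsAssocScalar (ω : G → G → G → kˣ) : Prop :=
  ∀ {V W U : GrVec k G} {x y z : G} {v : V.carrier} {w : W.carrier} {u : U.carrier},
    v ∈ V.comp x → w ∈ W.comp y → u ∈ U.comp z →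
      lin (assoc φ V W U).hom ((v ⊗ₜ w) ⊗ₜ u) = (ω x y z : k) • (v ⊗ₜ (w ⊗ₜ u))

theorem lin_assoc_inv {ω : G → G → G → kˣ} (hω : IsAssocScalar φ ω) {V W U : GrVec k G}
    {x y z : G} {v : V.carrier} {w : W.carrier} {u : U.carrier}
    (hv : v ∈ V.comp x) (hw : w ∈ W.comp y) (hu : u ∈ U.comp z) :
    lin (assoc φ V W U).inv (v ⊗ₜ (w ⊗ₜ u)) = ((ω x y z)⁻¹ : k) • ((v ⊗ₜ w) ⊗ₜ u) := by
  have h1 := lin_hom_inv (assoc φ V W U) ((v ⊗ₜ w) ⊗ₜ u)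
  rw [hω hv hw hu, map_smul] at h1
  rw [← h1, smul_smul, inv_mul_cancel₀ (ω x y z).ne_zero, one_smul]

/-- Both sides of the pentagon are evaluated at the generator 1 ⊗ 1 ⊗ 1 ⊗ 1 of a product of
one-dimensional objects. Intermediate products are not of the form `simple`, but they contain
homogeneous tensors of the summed degree, which is why `IsAssocScalar` ranges over all objects. -/
theorem assocScalar_pentagon {ω : G → G → G → kˣ} (hω : IsAssocScalar φ ω) (x y z t : G) :
    ω y z t * ω x (y + z) t * ω x y z = ω (x + y) z t * ω x y (z + t) := by
  have h := MonoidalCategory.pentagon (C := GrVecTransported φ) (simple k x) (simple k y)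
    (simple k z) (simple k t)
  have h1 : TensorProduct.map LinearMap.id (lin (assoc φ (simple k y) (simple k z)
        (simple k t)).hom) (lin (assoc φ (simple k x) (tensor (simple k y) (simple k z))
        (simple k t)).hom (TensorProduct.map (lin (assoc φ (simple k x) (simple k y)
        (simple k z)).hom) LinearMap.id ((((1 : k) ⊗ₜ (1 : k)) ⊗ₜ (1 : k)) ⊗ₜ (1 : k)))) =
      lin (assoc φ (simple k x) (simple k y) (tensor (simple k z) (simple k t))).hom
        (lin (assoc φ (tensor (simple k x) (simple k y)) (simple k z) (simple k t)).hom
          ((((1 : k) ⊗ₜ (1 : k)) ⊗ₜ (1 : k)) ⊗ₜ (1 : k))) :=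
    LinearMap.congr_fun (congrArg (lin (k := k) (G := G)) h)
      ((((1 : k) ⊗ₜ (1 : k)) ⊗ₜ (1 : k)) ⊗ₜ (1 : k))
  have hx := one_mem_simple (k := k) x
  have hy := one_mem_simple (k := k) y
  have hz := one_mem_simple (k := k) z
  have ht := one_mem_simple (k := k) t
  rw [TensorProduct.map_tmul, hω hx hy hz,
    hω (V := tensor (simple k x) (simple k y)) (tmul_mem hx hy) hz ht,
    LinearMap.id_apply, ← TensorProduct.smul_tmul', map_smul, map_smul, map_smul,
    hω (W := tensor (simple k y) (simple k z)) hx (tmul_mem hy hz) ht,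
    hω (U := tensor (simple k z) (simple k t)) hx hy (tmul_mem hz ht),
    map_smul, TensorProduct.map_tmul, LinearMap.id_apply, hω hy hz ht,
    TensorProduct.tmul_smul, smul_smul, smul_smul, smul_smul] at h1
  have h2 := congrArg (fun s : k ⊗[k] (k ⊗[k] (k ⊗[k] k)) => TensorProduct.lid k k
    (TensorProduct.lid k _ (TensorProduct.lid k _ s))) h1
  simp only [map_smul, TensorProduct.lid_tmul, smul_eq_mul, mul_one] at h2
  apply Units.ext
  push_cast
  rw [← h2]; ring

section Braided

variable [BraidedCategory (GrVec k G)]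

/-- `c` gives the scalars by which the transported braiding acts. -/
def IsBraidScalar (c : G → G → kˣ) : Prop :=
  ∀ {V W : GrVec k G} {x y : G} {v : V.carrier} {w : W.carrier},
    v ∈ V.comp x → w ∈ W.comp y → lin (braid φ V W).hom (v ⊗ₜ w) = (c x y : k) • (w ⊗ₜ v)

theorem assocScalar_hexagon_right {ω : G → G → G → kˣ} (hω : IsAssocScalar φ ω)
    {c : G → G → kˣ} (hc : IsBraidScalar φ c) (x y z : G) :
    ω x y z * c x (y + z) * ω y z x = c x y * ω y x z * c x z := by
  have h := BraidedCategory.hexagon_forward (C := GrVecTransported φ) (simple k x) (simple k y)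
    (simple k z)
  have h1 : lin (assoc φ (simple k y) (simple k z) (simple k x)).hom
        (lin (braid φ (simple k x) (tensor (simple k y) (simple k z))).hom
        (lin (assoc φ (simple k x) (simple k y) (simple k z)).hom
          (((1 : k) ⊗ₜ (1 : k)) ⊗ₜ (1 : k)))) =
      TensorProduct.map LinearMap.id (lin (braid φ (simple k x) (simple k z)).hom)
        (lin (assoc φ (simple k y) (simple k x) (simple k z)).hom
        (TensorProduct.map (lin (braid φ (simple k x) (simple k y)).hom) LinearMap.id
          (((1 : k) ⊗ₜ (1 : k)) ⊗ₜ (1 : k)))) :=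
    LinearMap.congr_fun (congrArg (lin (k := k) (G := G)) h) (((1 : k) ⊗ₜ (1 : k)) ⊗ₜ (1 : k))
  have hx := one_mem_simple (k := k) x
  have hy := one_mem_simple (k := k) y
  have hz := one_mem_simple (k := k) z
  rw [TensorProduct.map_tmul, hc hx hy, hω hx hy hz,
    ← TensorProduct.smul_tmul', map_smul, map_smul, map_smul, map_smul,
    hc (W := tensor (simple k y) (simple k z)) hx (tmul_mem hy hz), map_smul,
    hω hy hz hx, LinearMap.id_apply, hω hy hx hz, map_smul,
    TensorProduct.map_tmul, hc hx hz, LinearMap.id_apply,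
    TensorProduct.tmul_smul, smul_smul, smul_smul, smul_smul, smul_smul] at h1
  have h2 := congrArg (fun s : k ⊗[k] (k ⊗[k] k) => TensorProduct.lid k k
    (TensorProduct.lid k _ s)) h1
  simp only [map_smul, TensorProduct.lid_tmul, smul_eq_mul, mul_one] at h2
  apply Units.ext
  push_cast
  exact h2

theorem assocScalar_hexagon_left {ω : G → G → G → kˣ} (hω : IsAssocScalar φ ω)
    {c : G → G → kˣ} (hc : IsBraidScalar φ c) (x y z : G) :
    (ω x y z)⁻¹ * c (x + y) z * (ω z x y)⁻¹ = c y z * (ω x z y)⁻¹ * c x z := by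
  have h := BraidedCategory.hexagon_reverse (C := GrVecTransported φ) (simple k x) (simple k y)
    (simple k z)
  have h1 : lin (assoc φ (simple k z) (simple k x) (simple k y)).inv
        (lin (braid φ (tensor (simple k x) (simple k y)) (simple k z)).hom
        (lin (assoc φ (simple k x) (simple k y) (simple k z)).inv
          ((1 : k) ⊗ₜ ((1 : k) ⊗ₜ (1 : k))))) =
      TensorProduct.map (lin (braid φ (simple k x) (simple k z)).hom) LinearMap.id
        (lin (assoc φ (simple k x) (simple k z) (simple k y)).inv
        (TensorProduct.map LinearMap.id (lin (braid φ (simple k y) (simple k z)).hom)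
          ((1 : k) ⊗ₜ ((1 : k) ⊗ₜ (1 : k))))) :=
    LinearMap.congr_fun (congrArg (lin (k := k) (G := G)) h) ((1 : k) ⊗ₜ ((1 : k) ⊗ₜ (1 : k)))
  have hx := one_mem_simple (k := k) x
  have hy := one_mem_simple (k := k) y
  have hz := one_mem_simple (k := k) z
  rw [TensorProduct.map_tmul, hc hy hz, lin_assoc_inv φ hω hx hy hz,
    TensorProduct.tmul_smul, map_smul, map_smul, map_smul, map_smul,
    hc (V := tensor (simple k x) (simple k y)) (tmul_mem hx hy) hz, map_smul,
    lin_assoc_inv φ hω hz hx hy, LinearMap.id_apply, lin_assoc_inv φ hω hx hz hy, map_smul,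
    TensorProduct.map_tmul, hc hx hz, LinearMap.id_apply,
    ← TensorProduct.smul_tmul', smul_smul, smul_smul, smul_smul, smul_smul] at h1
  have h2 := congrArg (fun s : (k ⊗[k] k) ⊗[k] k => TensorProduct.rid k k
    (TensorProduct.rid k _ s)) h1
  simp only [map_smul, TensorProduct.rid_tmul, smul_eq_mul, mul_one] at h2
  apply Units.ext
  push_cast
  exact h2

theorem isAbelianCocycle_scalar {ω : G → G → G → kˣ} (hω : IsAssocScalar φ ω)
    {c : G → G → kˣ} (hc : IsBraidScalar φ c) :
    IsAbelianCocycle (A := Additive kˣ) (fun x y z => .ofMul (ω x y z))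
      (fun x y => .ofMul (c x y)) where
  pentagon x y z t := congrArg Additive.ofMul (assocScalar_pentagon φ hω x y z t)
  hexagon_left x y z := by
    have := congrArg Additive.ofMul (assocScalar_hexagon_left φ hω hc x y z)
    simp only [ofMul_mul, ofMul_inv] at this
    linear_combination (norm := abel) this
  hexagon_right x y z := by
    have := congrArg Additive.ofMul (assocScalar_hexagon_right φ hω hc x y z)
    simp only [ofMul_mul] at this
    linear_combination (norm := abel) this

end Braided

/-! ### The given unit object and its scalars -/

section Unit

/-- The given unit object is isomorphic to `k` concentrated in degree `0`. -/
def unitIso : unit k G ≅ 𝟙_ (GrVec k G) :=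
  -- Uniqueness of units: 𝟙 ⊗ k is k by the given left constraint and 𝟙 by the standard right one.
  (leftUnit φ (unit k G)).symm ≪≫ rightUnitIso (𝟙_ (GrVec k G))

/-- A generator of the given unit object. -/
def unitElem : (𝟙_ (GrVec k G)).carrier := lin (unitIso φ).hom (1 : k)

theorem unitElem_mem : unitElem φ ∈ (𝟙_ (GrVec k G)).comp 0 :=
  lin_mem _ (mem_unit_zero 1)

theorem lin_unitIso (a : k) : lin (unitIso φ).hom a = a • unitElem φ := by
  rw [unitElem, ← map_smul, smul_eq_mul, mul_one]

theorem exists_leftUnit_scalar : ∃ l : G → k, ∀ {V : GrVec k G} {x : G} {v : V.carrier},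
    v ∈ V.comp x → lin (leftUnit φ V).hom (unitElem φ ⊗ₜ v) = l x • v := by
  refine ⟨fun x => lin (leftUnit φ (simple k x)).hom (unitElem φ ⊗ₜ (1 : k)),
    fun {V x v} hv => ?_⟩
  have := LinearMap.congr_fun (congrArg lin (leftUnit_natural φ (ofElem V hv)))
    (unitElem φ ⊗ₜ (1 : k))
  have ev := lin_ofElem_one V hv
  calc _ = lin (leftUnit φ V).hom (unitElem φ ⊗ₜ lin (ofElem V hv) (1 : k)) := by rw [ev]
    _ = lin (ofElem V hv) (lin (leftUnit φ (simple k x)).hom (unitElem φ ⊗ₜ (1 : k))) := this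
    _ = _ := rfl

theorem exists_rightUnit_scalar : ∃ r : G → k, ∀ {V : GrVec k G} {x : G} {v : V.carrier},
    v ∈ V.comp x → lin (rightUnit φ V).hom (v ⊗ₜ unitElem φ) = r x • v := by
  refine ⟨fun x => lin (rightUnit φ (simple k x)).hom ((1 : k) ⊗ₜ unitElem φ),
    fun {V x v} hv => ?_⟩
  have := LinearMap.congr_fun (congrArg lin (rightUnit_natural φ (ofElem V hv)))
    ((1 : k) ⊗ₜ unitElem φ)
  have ev := lin_ofElem_one V hv
  calc _ = lin (rightUnit φ V).hom (lin (ofElem V hv) (1 : k) ⊗ₜ unitElem φ) := by rw [ev]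
    _ = lin (ofElem V hv) (lin (rightUnit φ (simple k x)).hom ((1 : k) ⊗ₜ unitElem φ)) := this
    _ = _ := rfl

theorem unitElem_ne_zero : unitElem φ ≠ 0 := fun h => by
  have := lin_hom_inv (unitIso φ) (1 : k)
  change lin (unitIso φ).inv (unitElem φ) = _ at this
  rw [h, LinearMap.map_zero] at this
  exact zero_ne_one this

theorem leftUnit_scalar_ne_zero {l : G → k} (hl : ∀ {V : GrVec k G} {x : G} {v : V.carrier},
    v ∈ V.comp x → lin (leftUnit φ V).hom (unitElem φ ⊗ₜ v) = l x • v) (x : G) : l x ≠ 0 := by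
  intro h
  have h1 := hl (one_mem_simple (k := k) x)
  have h2 := lin_hom_inv (leftUnit φ (simple k x)) (unitElem φ ⊗ₜ (1 : k))
  rw [h1, h, zero_smul, LinearMap.map_zero] at h2
  have h3 := congrArg (TensorProduct.rid k (𝟙_ (GrVec k G)).carrier) h2
  rw [map_zero] at h3
  refine unitElem_ne_zero φ ?_
  simpa using h3.symm

theorem unit_scalar_triangle {ω : G → G → G → kˣ} (hω : IsAssocScalar φ ω) {l r : G → k}
    (hl : ∀ {V : GrVec k G} {x : G} {v : V.carrier},
      v ∈ V.comp x → lin (leftUnit φ V).hom (unitElem φ ⊗ₜ v) = l x • v)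
    (hr : ∀ {V : GrVec k G} {x : G} {v : V.carrier},
      v ∈ V.comp x → lin (rightUnit φ V).hom (v ⊗ₜ unitElem φ) = r x • v) (x y : G) :
    ω x 0 y * l y = r x := by
  have h := MonoidalCategory.triangle (C := GrVecTransported φ) (simple k x) (simple k y)
  have h1 : TensorProduct.map LinearMap.id (lin (leftUnit φ (simple k y)).hom)
        (lin (assoc φ (simple k x) (𝟙_ (GrVec k G)) (simple k y)).hom
          (((1 : k) ⊗ₜ unitElem φ) ⊗ₜ (1 : k))) =
      TensorProduct.map (lin (rightUnit φ (simple k x)).hom) LinearMap.id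
        (((1 : k) ⊗ₜ unitElem φ) ⊗ₜ (1 : k)) :=
    LinearMap.congr_fun (congrArg (lin (k := k) (G := G)) h) (((1 : k) ⊗ₜ unitElem φ) ⊗ₜ (1 : k))
  have hx := one_mem_simple (k := k) x
  have hy := one_mem_simple (k := k) y
  rw [hω hx (unitElem_mem φ) hy, map_smul, TensorProduct.map_tmul, TensorProduct.map_tmul,
    hl hy, hr hx, LinearMap.id_apply, TensorProduct.tmul_smul, smul_smul,
    ← TensorProduct.smul_tmul'] at h1
  have h2 := congrArg (TensorProduct.lid k k) h1
  simpa using h2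

end Unit

end GrVecTransported

/-! ### The tensor equivalence attached to a cochain -/

namespace GrVecTransported

open GrVec

variable {k : Type u} [Field k] {G : Type w} [DecidableEq G] [Fintype G] [AddCommGroup G]

/-- The automorphism of the tensor product given by `h x y` on homogeneous elements of
degrees `x`, `y`. -/
def scale (h : G → G → kˣ) (V W : GrVec k G) : tensor V W ≅ tensor V W :=
  -- Following the twisted flip by the plain flip leaves only the scalar, with invertibility and
  -- degree preservation already known.
  braidIso h V W ≪≫ braidIso (fun _ _ => 1) W V

theorem lin_scale (h : G → G → kˣ) {V W : GrVec k G} {x y : G} {v : V.carrier} {w : W.carrier}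
    (hv : v ∈ V.comp x) (hw : w ∈ W.comp y) :
    lin (scale h V W).hom (v ⊗ₜ w) = (h x y : k) • (v ⊗ₜ w) := by
  change braidLin (fun _ _ => 1) W V (braidLin h V W (v ⊗ₜ w)) = _
  rw [braidLin_tmul _ hv hw, map_smul, braidLin_tmul _ hw hv, Units.val_one, one_smul]

theorem scale_natural (h : G → G → kˣ) {V V' W W' : GrVec k G} (f : V ⟶ V')
    (g : W ⟶ W') : tensorMap f g ≫ (scale h V' W').hom = (scale h V W).hom ≫ tensorMap f g := by
  refine hom_ext (ext_tmul V W fun x y v hv w hw => ?_)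
  change lin (scale h V' W').hom (lin f v ⊗ₜ lin g w) =
    TensorProduct.map (lin f) (lin g) (lin (scale h V W).hom (v ⊗ₜ w))
  rw [lin_scale h hv hw, lin_scale h (lin_mem f hv) (lin_mem g hw), map_smul,
    TensorProduct.map_tmul]

theorem scale_natural_assoc (h : G → G → kˣ) {V V' W W' : GrVec k G} (f : V ⟶ V')
    (g : W ⟶ W') {Z : GrVec k G} (t : tensor V' W' ⟶ Z) :
    tensorMap f g ≫ (scale h V' W').hom ≫ t = (scale h V W).hom ≫ tensorMap f g ≫ t := by
  rw [← Category.assoc, scale_natural, Category.assoc]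

variable [MonoidalCategory (GrVec k G)]
  (φ : curriedTensor (GrVec k G) ≅ GrVec.tensorFunctor k G)

/-- The comparison of the graded tensor product with the given one, rescaled by `h`. -/
def tensorator (h : G → G → kˣ) (V W : GrVec k G) : tensor V W ≅ V ⊗ W :=
  scale h V W ≪≫ (compIso φ V W).symm

theorem tensorator_natural_left (h : G → G → kˣ) {V V' : GrVec k G} (f : V ⟶ V')
    (W : GrVec k G) :
    tensorMap f (𝟙 W) ≫ (tensorator φ h V' W).hom = (tensorator φ h V W).hom ≫ f ▷ W := by
  simp only [tensorator, Iso.trans_hom, Iso.symm_hom, scale_natural_assoc,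
    compIso_inv_natural_left, Category.assoc]

theorem tensorator_natural_right (h : G → G → kˣ) (V : GrVec k G) {W W' : GrVec k G}
    (f : W ⟶ W') :
    tensorMap (𝟙 V) f ≫ (tensorator φ h V W').hom = (tensorator φ h V W).hom ≫ V ◁ f := by
  simp only [tensorator, Iso.trans_hom, Iso.symm_hom, scale_natural_assoc,
    compIso_inv_natural_right, Category.assoc]

theorem scale_assoc {ω : G → G → G → kˣ} (hω : IsAssocScalar φ ω) {Φ : G → G → G → kˣ}
    {h : G → G → kˣ}
    (hh : ∀ x y z, h x y * h (x + y) z * ω x y z = Φ x y z * (h y z * h x (y + z)))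
    (V W U : GrVec k G) :
    tensorMap (scale h V W).hom (𝟙 U) ≫ (scale h (tensor V W) U).hom ≫ (assoc φ V W U).hom =
      (assocIso Φ V W U).hom ≫ tensorMap (𝟙 V) (scale h W U).hom ≫
        (scale h V (tensor W U)).hom := by
  refine hom_ext (ext_tmul₃ V W U fun x y z v hv w hw u hu => ?_)
  change lin (assoc φ V W U).hom (lin (scale h (tensor V W) U).hom
      (TensorProduct.map (lin (scale h V W).hom) LinearMap.id ((v ⊗ₜ w) ⊗ₜ u))) =
    lin (scale h V (tensor W U)).hom (TensorProduct.map LinearMap.id (lin (scale h W U).hom)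
      (assocLin Φ V W U ((v ⊗ₜ w) ⊗ₜ u)))
  rw [TensorProduct.map_tmul, lin_scale h hv hw, LinearMap.id_apply, ← TensorProduct.smul_tmul',
    map_smul, map_smul, lin_scale (V := tensor V W) h (tmul_mem hv hw) hu, map_smul, hω hv hw hu,
    assocLin_tmul Φ hv hw hu, map_smul, map_smul, TensorProduct.map_tmul, LinearMap.id_apply,
    lin_scale h hw hu, TensorProduct.tmul_smul, map_smul,
    lin_scale (W := tensor W U) h hv (tmul_mem hw hu), smul_smul, smul_smul, smul_smul, smul_smul]
  congr 1
  have := congrArg Units.val (hh x y z)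
  simp only [Units.val_mul] at this
  rw [this, mul_assoc]

/-- The transported associator is the given one conjugated by `compIso`, so the hexagon for the
tensorator reduces to `scale_assoc`, where on homogeneous tensors it is the cohomology relation for
h. -/
theorem tensorator_assoc {ω : G → G → G → kˣ} (hω : IsAssocScalar φ ω) {Φ : G → G → G → kˣ}
    {h : G → G → kˣ}
    (hh : ∀ x y z, h x y * h (x + y) z * ω x y z = Φ x y z * (h y z * h x (y + z)))
    (V W U : GrVec k G) :
    tensorMap (tensorator φ h V W).hom (𝟙 U) ≫ (tensorator φ h (V ⊗ W) U).hom ≫ (α_ V W U).hom =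
      (assocIso Φ V W U).hom ≫ tensorMap (𝟙 V) (tensorator φ h W U).hom ≫
        (tensorator φ h V (W ⊗ U)).hom := by
  have hl : tensorMap (tensorator φ h V W).hom (𝟙 U) =
      tensorMap (scale h V W).hom (𝟙 U) ≫ tensorMap (compIso φ V W).inv (𝟙 U) :=
    hom_ext (TensorProduct.ext' fun _ _ => rfl)
  have hr : tensorMap (𝟙 V) (tensorator φ h W U).hom =
      tensorMap (𝟙 V) (scale h W U).hom ≫ tensorMap (𝟙 V) (compIso φ W U).inv :=
    hom_ext (TensorProduct.ext' fun _ _ => rfl)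
  have ha : (compIso φ (tensor V W) U).inv ≫ (compIso φ V W).inv ▷ U ≫ (α_ V W U).hom =
      (assoc φ V W U).hom ≫ (compIso φ V (tensor W U)).inv ≫ V ◁ (compIso φ W U).inv := by
    simp [assoc]
  have key := scale_assoc φ hω hh V W U
  simp only [scale_natural, scale_natural_assoc] at key
  rw [hl, hr]
  simp only [tensorator, Iso.trans_hom, Iso.symm_hom, Category.assoc, scale_natural_assoc,
    compIso_inv_natural_left_assoc, compIso_inv_natural_right, ha]
  rw [reassoc_of% key]

/-- A rescaling of `unitIso`. -/
def scaledUnitIso (s : kˣ) : unit k G ≅ 𝟙_ (GrVec k G) where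
  hom := (s : k) • (unitIso φ).hom
  inv := ((s⁻¹ : kˣ) : k) • (unitIso φ).inv
  hom_inv_id := by simp [smul_smul]
  inv_hom_id := by simp [smul_smul]

theorem lin_scaledUnitIso (s : kˣ) (a : k) :
    lin (scaledUnitIso φ s).hom a = (s * a : k) • unitElem φ := by
  rw [mul_smul, ← lin_unitIso]; rfl

theorem tensorator_leftUnit {h : G → G → kˣ} {s : kˣ} {l : G → k}
    (hl : ∀ {V : GrVec k G} {x : G} {v : V.carrier},
      v ∈ V.comp x → lin (leftUnit φ V).hom (unitElem φ ⊗ₜ v) = l x • v)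
    (hs : ∀ x, s * (h 0 x * l x) = 1) (V : GrVec k G) :
    (leftUnitIso V).hom = tensorMap (scaledUnitIso φ s).hom (𝟙 V) ≫
      (tensorator φ h (𝟙_ (GrVec k G)) V).hom ≫ (λ_ V).hom := by
  have hL : (compIso φ (𝟙_ (GrVec k G)) V).inv ≫ (λ_ V).hom = (leftUnit φ V).hom := by
    simp [leftUnit]
  rw [tensorator, Iso.trans_hom, Iso.symm_hom, Category.assoc, hL]
  refine hom_ext (ext_tmul (unit k G) V fun _ x a _ v hv => ?_)
  change TensorProduct.lid k V.carrier (a ⊗ₜ v) = lin (leftUnit φ V).hom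
    (lin (scale h (𝟙_ (GrVec k G)) V).hom (lin (scaledUnitIso φ s).hom a ⊗ₜ v))
  rw [lin_scaledUnitIso, ← TensorProduct.smul_tmul', map_smul, map_smul,
    lin_scale h (unitElem_mem φ) hv, map_smul, hl hv, smul_smul, smul_smul, TensorProduct.lid_tmul]
  congr 1
  linear_combination (-a) * hs x

theorem tensorator_rightUnit {h : G → G → kˣ} {s : kˣ} {r : G → k}
    (hr : ∀ {V : GrVec k G} {x : G} {v : V.carrier},
      v ∈ V.comp x → lin (rightUnit φ V).hom (v ⊗ₜ unitElem φ) = r x • v)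
    (hs : ∀ x, s * (h x 0 * r x) = 1) (V : GrVec k G) :
    (rightUnitIso V).hom = tensorMap (𝟙 V) (scaledUnitIso φ s).hom ≫
      (tensorator φ h V (𝟙_ (GrVec k G))).hom ≫ (ρ_ V).hom := by
  have hR : (compIso φ V (𝟙_ (GrVec k G))).inv ≫ (ρ_ V).hom = (rightUnit φ V).hom := by
    simp [rightUnit]
  rw [tensorator, Iso.trans_hom, Iso.symm_hom, Category.assoc, hR]
  refine hom_ext (ext_tmul V (unit k G) fun x _ v hv a _ => ?_)
  change TensorProduct.rid k V.carrier (v ⊗ₜ a) = lin (rightUnit φ V).hom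
    (lin (scale h V (𝟙_ (GrVec k G))).hom (v ⊗ₜ lin (scaledUnitIso φ s).hom a))
  rw [lin_scaledUnitIso, TensorProduct.tmul_smul, map_smul, map_smul,
    lin_scale h hv (unitElem_mem φ), map_smul, hr hv, smul_smul, smul_smul, TensorProduct.rid_tmul]
  congr 1
  linear_combination (-a) * hs x

variable [BraidedCategory (GrVec k G)]

theorem tensorator_braid {c : G → G → kˣ} (hc : IsBraidScalar φ c) {R h : G → G → kˣ}
    (hh : ∀ x y, h x y * c x y = R x y * h y x) (V W : GrVec k G) :
    (tensorator φ h V W).hom ≫ (β_ V W).hom =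
      (braidIso R V W).hom ≫ (tensorator φ h W V).hom := by
  have hb : (compIso φ V W).inv ≫ (β_ V W).hom = (braid φ V W).hom ≫ (compIso φ W V).inv := by
    simp [braid]
  have key : (scale h V W).hom ≫ (braid φ V W).hom = (braidIso R V W).hom ≫ (scale h W V).hom := by
    refine hom_ext (ext_tmul V W fun x y v hv w hw => ?_)
    change lin (braid φ V W).hom (lin (scale h V W).hom (v ⊗ₜ w)) =
      lin (scale h W V).hom (braidLin R V W (v ⊗ₜ w))
    rw [lin_scale h hv hw, map_smul, hc hv hw, braidLin_tmul _ hv hw, map_smul,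
      lin_scale h hw hv, smul_smul, smul_smul]
    congr 1
    exact congrArg Units.val (hh x y)
  simp only [tensorator, Iso.trans_hom, Iso.symm_hom, Category.assoc, hb]
  rw [reassoc_of% key]

/-- The identity functor from `Vec_G` with the given structure to `(Vec_G^Φ, R)`. -/
def toGrVecBr {Φ : ThreeCocycle k G} (R : QuasiBicharacter Φ) : GrVec k G ⥤ GrVecBr R :=
  𝟭 (GrVec k G)

theorem tensorEquivalent_of_cohomologous {ω : G → G → G → kˣ} (hω : IsAssocScalar φ ω)
    {c : G → G → kˣ} (hc : IsBraidScalar φ c) {Φ : ThreeCocycle k G} (R : QuasiBicharacter Φ)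
    {h : G → G → kˣ}
    (hΦ : ∀ x y z, h x y * h (x + y) z * ω x y z = Φ.toFun x y z * (h y z * h x (y + z)))
    (hR : ∀ x y, h x y * c x y = R.toFun x y * h y x) :
    TensorEquivalent k (GrVec k G) (GrVecBr R) := by
  obtain ⟨l, hl⟩ := exists_leftUnit_scalar φ
  obtain ⟨r, hr⟩ := exists_rightUnit_scalar φ
  have hl0 := leftUnit_scalar_ne_zero φ hl 0
  have htri := unit_scalar_triangle φ hω hl hr
  -- The cohomology relation at (x,0,y), with Φ normalized, combines with the triangle. The left
  -- side does not involve y and the right side does not involve x, so both are one constant, and a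
  -- single rescaling s of the unit satisfies both unit axioms.
  have hconst : ∀ x y, (h x 0 * r x : k) = h 0 y * l y := fun x y => by
    have h1 := congrArg Units.val (hΦ x 0 y)
    rw [Φ.normalized x 0 y (Or.inr (Or.inl rfl)), add_zero, zero_add, one_mul] at h1
    push_cast at h1
    rw [← htri x y]
    refine mul_left_cancel₀ (h x y).ne_zero ?_
    linear_combination l y * h1
  let s : kˣ := (h 0 0 * Units.mk0 (l 0) hl0)⁻¹
  have hs0 : (s * (h 0 0 * l 0) : k) = 1 :=
    congrArg Units.val (inv_mul_cancel (h 0 0 * Units.mk0 (l 0) hl0))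
  have hsl : ∀ x, (s * (h 0 x * l x) : k) = 1 := fun x => by
    rw [← hconst 0 x, hconst 0 0, hs0]
  have hsr : ∀ x, (s * (h x 0 * r x) : k) = 1 := fun x => by
    rw [hconst x 0, hs0]
  let F := toGrVecBr R
  let core : F.CoreMonoidal :=
    { εIso := scaledUnitIso φ s
      μIso := fun V W => tensorator φ h V W
      μIso_hom_natural_left := fun f W => tensorator_natural_left φ h f W
      μIso_hom_natural_right := fun V f => tensorator_natural_right φ h V f
      associativity := fun V W U => tensorator_assoc φ hω hΦ V W U
      left_unitality := fun V => tensorator_leftUnit φ hl hsl V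
      right_unitality := fun V => tensorator_rightUnit φ hr hsr V }
  let mon : F.Monoidal := core.toMonoidal
  let br : F.Braided :=
    { toMonoidal := mon
      braided := fun V W => tensorator_braid φ hc hR V W }
  exact ⟨F, br, inferInstanceAs (𝟭 (GrVec k G)).IsEquivalence,
    inferInstanceAs (𝟭 (GrVec k G)).Additive, inferInstanceAs ((𝟭 (GrVec k G)).Linear k)⟩

end GrVecTransported

end

/-! ### The classification theorem -/

theorem theorem4p2 {k : Type u} [Field k] [IsAlgClosed k] [CharZero k]
    (m n : ℕ) [NeZero m] [NeZero n]
    (ζm ζn : kˣ) (hm : IsPrimitiveRoot ζm m) (hn : IsPrimitiveRoot ζn n)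
    [MonoidalCategory (GrVec k (ZMod m × ZMod n))]
    [BraidedCategory (GrVec k (ZMod m × ZMod n))]
    (h : Nonempty (curriedTensor (GrVec k (ZMod m × ZMod n)) ≅
      GrVec.tensorFunctor k (ZMod m × ZMod n))) :
    ∃ a b d : ℕ, a < m ∧ b < Nat.gcd m n ∧ d < n ∧ ∃ r : ParamABD m n ζm ζn a b d,
      TensorEquivalent k (GrVec k (ZMod m × ZMod n))
        (GrVecBr (quasiBicharacterABD ζm ζn hm.pow_eq_one hn.pow_eq_one a b d r)) := by
  obtain ⟨φ⟩ := h
  obtain ⟨ω, hω⟩ := GrVec.exists_scalar_of_natural₃ (GrVecTransported.assoc φ)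
    (GrVecTransported.assoc_natural φ)
  obtain ⟨c, hc⟩ := GrVec.exists_scalar_of_natural₂ (GrVecTransported.braid φ)
    (GrVecTransported.braid_natural φ)
  obtain ⟨a, ha, d, hd, r, g, hΦ, hR⟩ := exists_cohomologous_quasiBicharacterABD hm hn
    (GrVecTransported.isAbelianCocycle_scalar φ hω hc)
  exact ⟨a, 0, d, ha, Nat.gcd_pos_of_pos_left n (Nat.pos_of_neZero m), hd, r,
    GrVecTransported.tensorEquivalent_of_cohomologous φ hω hc _ hΦ hR⟩
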